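/- Let $n\ge 3$ and $\alpha\in(-1,n-2]$. Let $W_\alpha(x)=\frac{1}{|x|^{n-2}}+\alpha\frac{x_1^2}{|x|^n}$ for $x\in\mathbb R^n\setminus\{0\}$ and $W_\alpha(0)=+\infty$. For a Borel probability measure $\mu$ on $\mathbb R^n$ (written $\mu\in\mathcal P(\mathbb R^n)$), let $$I_\alpha(\mu)=\iint_{\mathbb R^n\times\mathbb R^n}W_\alpha(x-y)\,d\mu(x)\,d\mu(y)+\int_{\mathbb R^n}|x|^2\,d\mu(x),$$ where the double integral is called the interaction energy of $\mu$. Then: 1. $I_\alpha(\mu)$ is well defined in $[0,+\infty]$ for every $\mu\in\mathcal P(\mathbb R^n)$. 2. $W_\alpha$ is a tempered distribution, and its Fourier transform is given by a function in $L^1_{\mathrm{loc}}(\mathbb R^n)$ that is positive almost everywhere. (The Fourier transform is defined by $\langle\widehat W_\alpha,\varphi\rangle=\langle W_\alpha,\widehat\varphi\rangle$, with $\widehat\varphi(\xi)=\int\varphi(x)e^{-2\pi i\xi\cdot x}\,dx$ for Schwartz functions $\varphi$.) 3. The set $\mathcal C$ of $\mu\in\mathcal P(\mathbb R^n)$ with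 compact support and finite interaction energy is convex, $I_\alpha$ is finite on $\mathcal C$, and $I_\alpha$ is strictly convex on $\mathcal C$: for $\mu,\nu\in\mathcal C$ with $\mu\ne\nu$ and $s,t>0$ with $s+t=1$, $$I_\alpha(s\mu+t\nu)<s\,I_\alpha(\mu)+t\,I_\alpha(\nu).$$ 4. $I_\alpha$ has a unique minimiser in $\mathcal P(\mathbb R^n)$. The minimiser has compact support and finite energy. -/

import Mathlib

open MeasureTheory
open scoped ENNReal NNReal FourierTransform SchwartzMap

noncomputable section

/-- The integral of an extended-real-valued function: integral of the positive part minus integral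
of the negative part. It is meaningful under `HasExtIntegral`. -/
def extIntegral {X : Type*} [MeasurableSpace X] (f : X → EReal) (μ : Measure X) : EReal :=
  ((∫⁻ x, (f x).toENNReal ∂μ : ℝ≥0∞) : EReal) - ((∫⁻ x, (-f x).toENNReal ∂μ : ℝ≥0∞) : EReal)

/-- The integral of `f` is well defined in `[-∞, +∞]`: `f` is measurable, and its positive and
negative parts do not both have infinite integral. -/
def HasExtIntegral {X : Type*} [MeasurableSpace X] (f : X → EReal) (μ : Measure X) : Prop :=
  AEMeasurable f μ ∧ (∫⁻ x, (f x).toENNReal ∂μ ≠ ∞ ∨ ∫⁻ x, (-f x).toENNReal ∂μ ≠ ∞)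

/-- The interaction potential `W_α(x) = |x|^{-(n-2)} + α x₁² / |x|^n` for `x ≠ 0`, with
`W_α(0) = +∞` (for `n ≥ 3`). The first coordinate `x₁` is `x 0`. -/
def interactionPotential {n : ℕ} [NeZero n] (α : ℝ) (x : EuclideanSpace ℝ (Fin n)) : EReal :=
  if x = 0 then ⊤
  else ((1 / ‖x‖ ^ (n - 2) + α * ((x 0) ^ 2 / ‖x‖ ^ n) : ℝ) : EReal)

/-- The interaction energy `∬ W_α(x - y) dμ(x) dμ(y)`. -/
def interactionEnergy {n : ℕ} [NeZero n] (α : ℝ) (μ : Measure (EuclideanSpace ℝ (Fin n))) : EReal :=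
  extIntegral (fun p : EuclideanSpace ℝ (Fin n) × EuclideanSpace ℝ (Fin n) =>
    interactionPotential α (p.1 - p.2)) (μ.prod μ)

/-- The energy `I_α(μ) = ∬ W_α(x - y) dμ(x) dμ(y) + ∫ |x|² dμ(x)`. -/
def energy {n : ℕ} [NeZero n] (α : ℝ) (μ : Measure (EuclideanSpace ℝ (Fin n))) : EReal :=
  interactionEnergy α μ + ((∫⁻ x, ‖x‖ₑ ^ 2 ∂μ : ℝ≥0∞) : EReal)

/-- `I_α(μ)` is well defined: the double integral is well defined, and the sum with the
(non-negative, possibly infinite) second moment is not of the form `-∞ + ∞`. -/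
def EnergyWellDefined {n : ℕ} [NeZero n] (α : ℝ) (μ : Measure (EuclideanSpace ℝ (Fin n))) : Prop :=
  HasExtIntegral (fun p : EuclideanSpace ℝ (Fin n) × EuclideanSpace ℝ (Fin n) =>
    interactionPotential α (p.1 - p.2)) (μ.prod μ) ∧
  interactionEnergy α μ ≠ ⊥

/-- Probability measures with compact support and finite interaction energy. -/
def compactFiniteEnergyClass (n : ℕ) [NeZero n] (α : ℝ) :
    Set (Measure (EuclideanSpace ℝ (Fin n))) :=
  {μ | IsProbabilityMeasure μ ∧ IsCompact μ.support ∧ interactionEnergy α μ < ⊤}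

/-- The tempered distribution `T` is the function `f`, i.e. `⟨T, φ⟩ = ∫ f φ` for all Schwartz
functions `φ`, with absolutely convergent integrals. -/
def IsGivenByFunction {n : ℕ} (T : 𝓢'(EuclideanSpace ℝ (Fin n), ℂ))
    (f : EuclideanSpace ℝ (Fin n) → ℝ) : Prop :=
  ∀ φ : 𝓢(EuclideanSpace ℝ (Fin n), ℂ),
    Integrable (fun x => (f x : ℂ) * φ x) ∧ T φ = ∫ x, (f x : ℂ) * φ x

/-- `μ` minimises `I_α` over all Borel probability measures. -/
def IsEnergyMinimiser {n : ℕ} [NeZero n] (α : ℝ)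
    (μ : ProbabilityMeasure (EuclideanSpace ℝ (Fin n))) : Prop :=
  ∀ ν : ProbabilityMeasure (EuclideanSpace ℝ (Fin n)),
    energy α (μ : Measure (EuclideanSpace ℝ (Fin n))) ≤ energy α (ν : Measure (EuclideanSpace ℝ (Fin n)))

end

/-!
The argument rests on one decomposition. Write `x = (x₁, x')` and let
`quad α x = (n - 2 - α) x₁² + (n - 2 + α) |x'|²`, a quadratic form which, for
`-1 < α ≤ n - 2`, is nonnegative and vanishes on a null set only; the bound `α > -1` also makes `W`
comparable to the Riesz kernel `|x|^(2 - n)`. For `x ≠ 0`,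
`4 Γ(n/2) W(x) = ∫_{t > 0} t^(n/2 - 2) k_t(x) dt`, where
`k_t(x) = ((n - 2)(n + α) - 2 t quad α x) exp (-t |x|²)` (`integral_profile`).
The function `k_t` is a positive multiple of the Fourier transform of
`quad α ξ exp (-π² |ξ|² / t)` (`fourier_dualProfile`), so the potential is a superposition of positive
definite functions. The integral converges absolutely, with absolute value at most a constant
times `|x|^(2 - n)`, hence at most a constant times `W`
(`lintegral_profile_le_riesz`, `riesz_le_potential`), so that all interchanges of integrals are
instances of Fubini's theorem.

* Tested against Schwartz functions, the decomposition shows that the Fourier transform of `W` is a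
  positive multiple of `quad α ξ / |ξ|⁴` (`integral_realPotential_mul_fourier`).
* Integrated against `(μ - ν) × (μ - ν)`, it shows that the interaction energy of `μ - ν` is
  a positive superposition of the integrals of `quad α ξ exp (-π² |ξ|² / t) |μ̂ - ν̂|²`, and so is
  positive unless `μ = ν` (`mutualEnergy_strict`). This requires the mutual energy of `μ` and `ν` to
  be finite, which follows by comparison with the Riesz kernel, a superposition of pointwise positive
  and positive definite Gaussians (`riesz_cross_le`). Strict convexity of the energy on
  all measures of finite energy results (`totalEnergy_strictConvex`), and with it the uniqueness of
  the minimiser.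
* A minimiser exists because the energy is lower semicontinuous for weak convergence and its
  sublevel sets are tight, by the second moment (`exists_minimiser`). Its support is compact: if it
  had mass outside of a large ball, normalising its restriction to the ball would
  decrease the energy (`isCompact_support_of_minimiser`).
-/

open MeasureTheory
open scoped ENNReal NNReal FourierTransform SchwartzMap

noncomputable section

open Real Set Filter Topology

namespace AnisotropicEnergy

variable {n : ℕ}

/-! ### The potential, its Riesz majorant and its Gaussian decomposition -/

/-- Euclidean space of dimension `n`. -/
abbrev Eucl (n : ℕ) := EuclideanSpace ℝ (Fin n)

/-- The real values of the interaction potential. Since `1 / 0 = 0`, its value at the origin is `0`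
when `n ≥ 3`, which agrees with `EReal.toReal ⊤`. -/
def realPotential [NeZero n] (α : ℝ) (x : Eucl n) : ℝ :=
  1 / ‖x‖ ^ (n - 2) + α * ((x 0) ^ 2 / ‖x‖ ^ n)

/-- The interaction potential with values in `[0, ∞]`. -/
def potential [NeZero n] (α : ℝ) (x : Eucl n) : ℝ≥0∞ :=
  (interactionPotential α x).toENNReal

lemma sq_coord_le (x : Eucl n) (i : Fin n) : (x i) ^ 2 ≤ ‖x‖ ^ 2 := by
  have := PiLp.norm_apply_le x i
  rw [Real.norm_eq_abs] at this
  rw [← sq_abs (x i)]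
  gcongr

lemma realPotential_eq_div [NeZero n] (hn : 3 ≤ n) (α : ℝ) {x : Eucl n} (hx : x ≠ 0) :
    realPotential α x = (1 + α * ((x 0) ^ 2 / ‖x‖ ^ 2)) / ‖x‖ ^ (n - 2) := by
  have h : ‖x‖ ≠ 0 := norm_ne_zero_iff.2 hx
  obtain ⟨m, rfl⟩ : ∃ m, n = m + 2 := ⟨n - 2, by omega⟩
  simp only [realPotential, Nat.add_sub_cancel, pow_add]
  field_simp

lemma coord_ratio_le_one (x : Eucl n) (i : Fin n) : (x i) ^ 2 / ‖x‖ ^ 2 ≤ 1 :=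
  div_le_one_of_le₀ (sq_coord_le x i) (by positivity)

lemma realPotential_le [NeZero n] (hn : 3 ≤ n) (α : ℝ) {x : Eucl n} (hx : x ≠ 0) :
    realPotential α x ≤ (1 + |α|) / ‖x‖ ^ (n - 2) := by
  rw [realPotential_eq_div hn α hx]
  have h1 := coord_ratio_le_one x 0
  have h0 : 0 ≤ (x 0) ^ 2 / ‖x‖ ^ 2 := by positivity
  gcongr
  calc α * ((x 0) ^ 2 / ‖x‖ ^ 2) ≤ |α| * ((x 0) ^ 2 / ‖x‖ ^ 2) := by gcongr; exact le_abs_self α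
    _ ≤ |α| * 1 := by gcongr
    _ = |α| := mul_one _

lemma le_realPotential [NeZero n] (hn : 3 ≤ n) (α : ℝ) {x : Eucl n} (hx : x ≠ 0) :
    min 1 (1 + α) / ‖x‖ ^ (n - 2) ≤ realPotential α x := by
  rw [realPotential_eq_div hn α hx]
  have h1 := coord_ratio_le_one x 0
  have h0 : 0 ≤ (x 0) ^ 2 / ‖x‖ ^ 2 := by positivity
  gcongr
  rcases le_total 0 α with h | h
  · exact (min_le_left _ _).trans (by nlinarith)
  · exact (min_le_right _ _).trans (by nlinarith)

lemma realPotential_zero [NeZero n] (hn : 3 ≤ n) (α : ℝ) : realPotential α (0 : Eucl n) = 0 := by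
  have h : n - 2 ≠ 0 := by omega
  simp [realPotential, h]

lemma realPotential_nonneg [NeZero n] (hn : 3 ≤ n) {α : ℝ} (hα : -1 < α) (x : Eucl n) :
    0 ≤ realPotential α x := by
  by_cases hx : x = 0
  · rw [hx, realPotential_zero hn]
  · have : 0 ≤ min 1 (1 + α) := le_min zero_le_one (by linarith)
    exact le_trans (by positivity) (le_realPotential hn α hx)

lemma interactionPotential_of_ne [NeZero n] (α : ℝ) {x : Eucl n} (hx : x ≠ 0) :
    interactionPotential α x = (realPotential α x : EReal) := by
  simp [interactionPotential, hx, realPotential]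

lemma toReal_interactionPotential [NeZero n] (hn : 3 ≤ n) (α : ℝ) (x : Eucl n) :
    (interactionPotential α x).toReal = realPotential α x := by
  by_cases hx : x = 0
  · rw [hx, realPotential_zero hn]; simp [interactionPotential]
  · rw [interactionPotential_of_ne α hx, EReal.toReal_coe]

lemma interactionPotential_nonneg [NeZero n] (hn : 3 ≤ n) {α : ℝ} (hα : -1 < α) (x : Eucl n) :
    0 ≤ interactionPotential α x := by
  by_cases hx : x = 0
  · simp [interactionPotential, hx]
  · rw [interactionPotential_of_ne α hx]
    exact_mod_cast realPotential_nonneg hn hα x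

lemma potential_of_ne [NeZero n] (α : ℝ) {x : Eucl n} (hx : x ≠ 0) :
    potential α x = ENNReal.ofReal (realPotential α x) := by
  rw [potential, interactionPotential_of_ne α hx, EReal.toENNReal_of_ne_top (EReal.coe_ne_top _),
    EReal.toReal_coe]

@[simp] lemma potential_zero [NeZero n] (α : ℝ) : potential α (0 : Eucl n) = ⊤ := by
  simp [potential, interactionPotential]

lemma measurable_realPotential [NeZero n] (α : ℝ) :
    Measurable (realPotential α : Eucl n → ℝ) := by
  unfold realPotential
  fun_prop

lemma measurable_interactionPotential [NeZero n] (α : ℝ) :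
    Measurable (interactionPotential α : Eucl n → EReal) := by
  unfold interactionPotential
  refine Measurable.ite (measurableSet_singleton 0) measurable_const ?_
  exact (measurable_realPotential α).coe_real_ereal

lemma measurable_potential [NeZero n] (α : ℝ) : Measurable (potential α : Eucl n → ℝ≥0∞) :=
  (measurable_interactionPotential α).ereal_toENNReal

lemma toReal_potential [NeZero n] (hn : 3 ≤ n) {α : ℝ} (hα : -1 < α) (x : Eucl n) :
    (potential α x).toReal = realPotential α x := by
  by_cases hx : x = 0
  · rw [hx, realPotential_zero hn]; simp
  · rw [potential_of_ne α hx, ENNReal.toReal_ofReal (realPotential_nonneg hn hα x)]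

/-- A multiple of the Riesz kernel `|x|^{-(n-2)}`, as a superposition of Gaussians. The value at the
origin is `∞`. -/
def riesz (x : Eucl n) : ℝ≥0∞ :=
  ∫⁻ t in Ioi (0 : ℝ), ENNReal.ofReal (t ^ ((n : ℝ) / 2 - 1 - 1) * exp (-(‖x‖ ^ 2 * t)))

lemma integrableOn_rpow_mul_exp {a r : ℝ} (ha : 0 < a) (hr : 0 < r) :
    IntegrableOn (fun t : ℝ => t ^ (a - 1) * exp (-(r * t))) (Ioi 0) := by
  by_contra h
  have h1 := integral_rpow_mul_exp_neg_mul_Ioi ha hr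
  rw [integral_undef h] at h1
  have : 0 < (1 / r) ^ a * Gamma a := mul_pos (by positivity) (Gamma_pos_of_pos ha)
  linarith

lemma lintegral_rpow_mul_exp {a r : ℝ} (ha : 0 < a) (hr : 0 < r) :
    ∫⁻ t in Ioi (0 : ℝ), ENNReal.ofReal (t ^ (a - 1) * exp (-(r * t))) =
      ENNReal.ofReal ((1 / r) ^ a * Gamma a) := by
  rw [← integral_rpow_mul_exp_neg_mul_Ioi ha hr,
    ofReal_integral_eq_lintegral_ofReal (integrableOn_rpow_mul_exp ha hr)]
  filter_upwards [ae_restrict_mem measurableSet_Ioi] with t ht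
  have : (0 : ℝ) < t := ht
  positivity

lemma half_dim_sub_one_pos (hn : 3 ≤ n) : 0 < (n : ℝ) / 2 - 1 := by
  have : (3 : ℝ) ≤ n := by exact_mod_cast hn
  linarith

lemma one_div_sq_rpow {r : ℝ} (hr : 0 < r) (m : ℕ) :
    (1 / r ^ 2) ^ ((m : ℝ) / 2) = 1 / r ^ m := by
  rw [div_rpow zero_le_one (by positivity), one_rpow, ← rpow_natCast r 2, ← rpow_mul hr.le,
    ← rpow_natCast r m]
  congr 2
  push_cast; ring

lemma one_div_sq_rpow_sub_one (hn : 3 ≤ n) {r : ℝ} (hr : 0 < r) :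
    (1 / r ^ 2) ^ ((n : ℝ) / 2 - 1) = 1 / r ^ (n - 2) := by
  rw [← one_div_sq_rpow hr (n - 2)]
  congr 1
  rw [Nat.cast_sub (by omega)]
  push_cast; ring

lemma riesz_of_ne (hn : 3 ≤ n) {x : Eucl n} (hx : x ≠ 0) :
    riesz x = ENNReal.ofReal (1 / ‖x‖ ^ (n - 2) * Gamma ((n : ℝ) / 2 - 1)) := by
  have h : 0 < ‖x‖ := norm_pos_iff.2 hx
  rw [riesz, lintegral_rpow_mul_exp (half_dim_sub_one_pos hn) (by positivity),
    one_div_sq_rpow_sub_one hn h]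

@[simp] lemma riesz_zero : riesz (0 : Eucl n) = ⊤ := by
  by_contra h
  refine not_integrableOn_Ioi_rpow ((n : ℝ) / 2 - 1 - 1) ?_
  simp only [riesz, norm_zero, ne_eq, OfNat.ofNat_ne_zero, not_false_eq_true, zero_pow, zero_mul,
    neg_zero, exp_zero, mul_one] at h
  refine ⟨by fun_prop, ?_⟩
  rw [hasFiniteIntegral_iff_ofReal]
  · exact lt_top_iff_ne_top.2 h
  · filter_upwards [ae_restrict_mem measurableSet_Ioi] with t ht
    have : (0 : ℝ) < t := ht
    positivity

lemma measurable_riesz : Measurable (riesz : Eucl n → ℝ≥0∞) := by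
  unfold riesz
  exact Measurable.lintegral_prod_right' (f := fun p : Eucl n × ℝ =>
    ENNReal.ofReal (p.2 ^ ((n : ℝ) / 2 - 1 - 1) * exp (-(‖p.1‖ ^ 2 * p.2)))) (by fun_prop)

lemma potential_le_riesz [NeZero n] (hn : 3 ≤ n) (α : ℝ) :
    ∃ C : ℝ≥0, ∀ x : Eucl n, potential α x ≤ C * riesz x := by
  have hG := Gamma_pos_of_pos (half_dim_sub_one_pos hn)
  have hC : 0 < (1 + |α|) / Gamma ((n : ℝ) / 2 - 1) := by positivity
  refine ⟨((1 + |α|) / Gamma ((n : ℝ) / 2 - 1)).toNNReal, fun x => ?_⟩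
  by_cases hx : x = 0
  · rw [hx, riesz_zero, ENNReal.mul_top]
    · exact le_top
    · simpa using hC
  · rw [potential_of_ne α hx, riesz_of_ne hn hx, ← ENNReal.ofReal, ← ENNReal.ofReal_mul hC.le]
    refine ENNReal.ofReal_le_ofReal ((realPotential_le hn α hx).trans_eq ?_)
    rw [mul_comm (1 / ‖x‖ ^ (n - 2)), ← mul_assoc, div_mul_cancel₀ _ hG.ne', mul_one_div]

lemma riesz_le_potential [NeZero n] (hn : 3 ≤ n) {α : ℝ} (hα : -1 < α) :
    ∃ C : ℝ≥0, ∀ x : Eucl n, riesz x ≤ C * potential α x := by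
  have hG := Gamma_pos_of_pos (half_dim_sub_one_pos hn)
  have hm : 0 < min 1 (1 + α) := lt_min zero_lt_one (by linarith)
  have hC : 0 < Gamma ((n : ℝ) / 2 - 1) / min 1 (1 + α) := by positivity
  refine ⟨(Gamma ((n : ℝ) / 2 - 1) / min 1 (1 + α)).toNNReal, fun x => ?_⟩
  by_cases hx : x = 0
  · rw [hx, potential_zero, ENNReal.mul_top]
    · exact le_top
    · simpa using div_pos hG hm
  · rw [potential_of_ne α hx, riesz_of_ne hn hx, ← ENNReal.ofReal, ← ENNReal.ofReal_mul hC.le]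
    refine ENNReal.ofReal_le_ofReal (le_trans (le_of_eq ?_)
      (mul_le_mul_of_nonneg_left (le_realPotential hn α hx) hC.le))
    field_simp

/-- The quadratic form `(n - 2 - α) x₁² + (n - 2 + α) |x'|²`, where `x = (x₁, x')`. Divided by
`|x|⁴`, it is the Fourier transform of the potential up to a positive constant. -/
def quad [NeZero n] (α : ℝ) (x : Eucl n) : ℝ :=
  ((n : ℝ) - 2 + α) * ‖x‖ ^ 2 - 2 * α * (x 0) ^ 2

/-- The positive definite functions of which the potential is a superposition: up to a positive
constant, the Fourier transform of `quad α ξ * exp (-π² |ξ|² / t)`. -/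
def profile [NeZero n] (α t : ℝ) (x : Eucl n) : ℝ :=
  (((n : ℝ) - 2) * (n + α) - 2 * t * quad α x) * exp (-(‖x‖ ^ 2 * t))

lemma quad_nonneg [NeZero n] (hn : 3 ≤ n) {α : ℝ} (hα : -1 < α) (hα' : α ≤ (n : ℝ) - 2)
    (x : Eucl n) : 0 ≤ quad α x := by
  have h3 : (3 : ℝ) ≤ n := by exact_mod_cast hn
  have h1 := sq_coord_le x 0
  have h0 : 0 ≤ (x 0) ^ 2 := by positivity
  unfold quad
  rcases le_total 0 α with h | h <;> nlinarith

lemma quad_le [NeZero n] (α : ℝ) (x : Eucl n) :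
    quad α x ≤ ((n : ℝ) - 2 + α + 2 * |α|) * ‖x‖ ^ 2 := by
  have h1 := sq_coord_le x 0
  have h0 : 0 ≤ (x 0) ^ 2 := by positivity
  have := neg_abs_le α
  have := abs_nonneg α
  unfold quad
  nlinarith

lemma continuous_quad [NeZero n] (α : ℝ) : Continuous (quad α : Eucl n → ℝ) := by
  unfold quad; fun_prop

lemma continuous_profile [NeZero n] (α : ℝ) :
    Continuous (fun p : ℝ × Eucl n => profile α p.1 p.2) := by
  unfold profile quad; fun_prop

/-- The key identity: the potential is a superposition of the functions `profile α t`. -/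
lemma integral_profile [NeZero n] (hn : 3 ≤ n) (α : ℝ) {x : Eucl n} (hx : x ≠ 0) :
    ∫ t in Ioi (0 : ℝ), t ^ ((n : ℝ) / 2 - 1 - 1) * profile α t x =
      4 * Gamma ((n : ℝ) / 2) * realPotential α x := by
  have h : 0 < ‖x‖ := norm_pos_iff.2 hx
  have hr : 0 < ‖x‖ ^ 2 := by positivity
  have ha := half_dim_sub_one_pos hn
  have ha' : 0 < (n : ℝ) / 2 := by linarith
  have i1 := (integrableOn_rpow_mul_exp ha hr).const_mul (((n : ℝ) - 2) * (n + α))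
  have i2 := (integrableOn_rpow_mul_exp ha' hr).const_mul (2 * quad α x)
  have e : ∀ t ∈ Ioi (0 : ℝ), t ^ ((n : ℝ) / 2 - 1 - 1) * profile α t x =
      ((n : ℝ) - 2) * (n + α) * (t ^ ((n : ℝ) / 2 - 1 - 1) * exp (-(‖x‖ ^ 2 * t))) -
      2 * quad α x * (t ^ ((n : ℝ) / 2 - 1) * exp (-(‖x‖ ^ 2 * t))) := by
    intro t ht
    have ht : (0 : ℝ) < t := ht
    have : t ^ ((n : ℝ) / 2 - 1) = t ^ ((n : ℝ) / 2 - 1 - 1) * t := by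
      rw [← rpow_add_one ht.ne']; congr 1; ring
    rw [this, profile]; ring
  rw [setIntegral_congr_fun measurableSet_Ioi e, integral_sub i1 i2, integral_const_mul,
    integral_const_mul, integral_rpow_mul_exp_neg_mul_Ioi ha hr,
    integral_rpow_mul_exp_neg_mul_Ioi ha' hr, one_div_sq_rpow_sub_one hn h, one_div_sq_rpow h]
  have hG : Gamma ((n : ℝ) / 2) = ((n : ℝ) / 2 - 1) * Gamma ((n : ℝ) / 2 - 1) := by
    rw [← Gamma_add_one ha.ne']; congr 1; ring
  rw [hG, realPotential, quad]
  obtain ⟨m, rfl⟩ : ∃ m, n = m + 2 := ⟨n - 2, by omega⟩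
  simp only [Nat.add_sub_cancel, pow_add]
  push_cast
  field_simp
  ring

/-- An absolute bound for `profile α t x`, up to the factor `exp (-|x|² t / 2)`. -/
def profileBound (n : ℕ) (α : ℝ) : ℝ :=
  |((n : ℝ) - 2) * (n + α)| + 4 * ((n : ℝ) - 2 + α + 2 * |α|)

lemma profileBound_nonneg (hn : 3 ≤ n) {α : ℝ} (hα : -1 < α) : 0 ≤ profileBound n α := by
  have h3 : (3 : ℝ) ≤ n := by exact_mod_cast hn
  have : 0 ≤ (n : ℝ) - 2 + α := by linarith
  unfold profileBound
  positivity

lemma abs_profile_le [NeZero n] (hn : 3 ≤ n) {α : ℝ} (hα : -1 < α) (hα' : α ≤ (n : ℝ) - 2)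
    {t : ℝ} (ht : 0 < t) (x : Eucl n) :
    |profile α t x| ≤ profileBound n α * exp (-(‖x‖ ^ 2 / 2 * t)) := by
  have h3 : (3 : ℝ) ≤ n := by exact_mod_cast hn
  have hc : 0 ≤ (n : ℝ) - 2 + α + 2 * |α| := by
    have : 0 ≤ (n : ℝ) - 2 + α := by linarith
    positivity
  set u := ‖x‖ ^ 2 / 2 * t with hu
  have hu0 : 0 ≤ u := by positivity
  have he : exp (-(‖x‖ ^ 2 * t)) = exp (-u) * exp (-u) := by
    rw [← exp_add, hu]; congr 1; ring
  have hu1 : u * exp (-u) ≤ 1 := by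
    have := add_one_le_exp u
    rw [exp_neg, ← div_eq_mul_inv, div_le_one (exp_pos _)]
    linarith
  have he1 : exp (-u) ≤ 1 := exp_le_one_iff.2 (by linarith)
  have hq0 := quad_nonneg hn hα hα' x
  have hq := quad_le α x
  have h1 : 2 * t * quad α x ≤ 4 * ((n : ℝ) - 2 + α + 2 * |α|) * u := by
    calc 2 * t * quad α x ≤ 2 * t * (((n : ℝ) - 2 + α + 2 * |α|) * ‖x‖ ^ 2) := by gcongr
      _ = _ := by rw [hu]; ring
  rw [profile, he, abs_mul, abs_of_pos (mul_pos (exp_pos _) (exp_pos _)), ← mul_assoc]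
  refine mul_le_mul_of_nonneg_right ?_ (exp_pos _).le
  calc |((n : ℝ) - 2) * (n + α) - 2 * t * quad α x| * exp (-u)
      ≤ (|((n : ℝ) - 2) * (n + α)| + 4 * ((n : ℝ) - 2 + α + 2 * |α|) * u) * exp (-u) := by
        gcongr
        refine (abs_sub _ _).trans ?_
        rw [abs_of_nonneg (a := 2 * t * quad α x) (by positivity)]
        gcongr
    _ = |((n : ℝ) - 2) * (n + α)| * exp (-u)
        + 4 * ((n : ℝ) - 2 + α + 2 * |α|) * (u * exp (-u)) := by ring
    _ ≤ |((n : ℝ) - 2) * (n + α)| * 1 + 4 * ((n : ℝ) - 2 + α + 2 * |α|) * 1 := by gcongr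
    _ = profileBound n α := by rw [profileBound]; ring

lemma lintegral_profile_le_riesz [NeZero n] (hn : 3 ≤ n) {α : ℝ} (hα : -1 < α)
    (hα' : α ≤ (n : ℝ) - 2) :
    ∃ C : ℝ≥0, ∀ x : Eucl n, ∫⁻ t in Ioi (0 : ℝ),
      ‖t ^ ((n : ℝ) / 2 - 1 - 1) * profile α t x‖ₑ ≤ C * riesz x := by
  have ha := half_dim_sub_one_pos hn
  have hB := profileBound_nonneg hn hα
  -- the summand `1` only serves to make the constant nonzero, for the case `x = 0`
  have hC : 0 < profileBound n α * 2 ^ ((n : ℝ) / 2 - 1) + 1 := by positivity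
  refine ⟨(profileBound n α * 2 ^ ((n : ℝ) / 2 - 1) + 1).toNNReal, fun x => ?_⟩
  by_cases hx : x = 0
  · rw [hx, riesz_zero, ENNReal.mul_top]
    · exact le_top
    · simpa using hC
  have h : 0 < ‖x‖ := norm_pos_iff.2 hx
  calc ∫⁻ t in Ioi (0 : ℝ), ‖t ^ ((n : ℝ) / 2 - 1 - 1) * profile α t x‖ₑ
      ≤ ∫⁻ t in Ioi (0 : ℝ), ENNReal.ofReal (profileBound n α) *
          ENNReal.ofReal (t ^ ((n : ℝ) / 2 - 1 - 1) * exp (-(‖x‖ ^ 2 / 2 * t))) := by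
        refine setLIntegral_mono' measurableSet_Ioi fun t ht => ?_
        have ht : (0 : ℝ) < t := ht
        rw [← ENNReal.ofReal_mul hB, Real.enorm_eq_ofReal_abs, abs_mul,
          abs_of_pos (rpow_pos_of_pos ht _)]
        refine ENNReal.ofReal_le_ofReal ?_
        calc _ ≤ t ^ ((n : ℝ) / 2 - 1 - 1) *
              (profileBound n α * exp (-(‖x‖ ^ 2 / 2 * t))) := by
              gcongr; exact abs_profile_le hn hα hα' ht x
          _ = _ := by ring
    _ = ENNReal.ofReal (profileBound n α) *
          ENNReal.ofReal ((1 / (‖x‖ ^ 2 / 2)) ^ ((n : ℝ) / 2 - 1) * Gamma ((n : ℝ) / 2 - 1)) := by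
        rw [lintegral_const_mul _ (by fun_prop), lintegral_rpow_mul_exp ha (by positivity)]
    _ ≤ _ := by
        rw [riesz_of_ne hn hx, ← ENNReal.ofReal, ← ENNReal.ofReal_mul hC.le,
          ← ENNReal.ofReal_mul hB]
        refine ENNReal.ofReal_le_ofReal ?_
        have hG := Gamma_pos_of_pos ha
        have : (1 / (‖x‖ ^ 2 / 2)) = 2 * (1 / ‖x‖ ^ 2) := by field_simp
        rw [this, mul_rpow (by positivity) (by positivity), one_div_sq_rpow_sub_one hn h]
        have h2 : 0 ≤ 1 / ‖x‖ ^ (n - 2) * Gamma ((n : ℝ) / 2 - 1) := by positivity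
        nlinarith

/-! ### Fourier transforms of polynomial multiples of Gaussians -/

open scoped RealInnerProductSpace ComplexConjugate

lemma integrable_norm_pow_mul_gaussian (hn : n ≠ 0) {b : ℝ} (hb : 0 < b) (k : ℕ) :
    Integrable (fun v : Eucl n => ‖v‖ ^ k * exp (-b * ‖v‖ ^ 2)) := by
  have : NeZero n := ⟨hn⟩
  refine (integrable_fun_norm_addHaar (volume : Measure (Eucl n))
    (f := fun y : ℝ => y ^ k * exp (-b * y ^ 2))).2 ?_
  have h := (integrable_rpow_mul_exp_neg_mul_sq hb (s := ((n - 1 + k : ℕ) : ℝ))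
    (lt_of_lt_of_le neg_one_lt_zero (Nat.cast_nonneg _))).integrableOn (s := Ioi 0)
  refine h.congr (ae_of_all _ fun y => ?_)
  simp only [rpow_natCast, pow_add, finrank_euclideanSpace, Fintype.card_fin, smul_eq_mul]
  ring

/-- The complex-valued Gaussian `exp (-b |v|²)`. -/
def cGauss (b : ℝ) (v : Eucl n) : ℂ := Complex.exp (-(b : ℂ) * ‖v‖ ^ 2)

lemma cGauss_eq_ofReal (b : ℝ) (v : Eucl n) : cGauss b v = ((exp (-b * ‖v‖ ^ 2) : ℝ) : ℂ) := by
  simp [cGauss]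

lemma continuous_cGauss (b : ℝ) : Continuous (cGauss b : Eucl n → ℂ) := by
  unfold cGauss; fun_prop

lemma norm_cGauss (b : ℝ) (v : Eucl n) : ‖cGauss b v‖ = exp (-b * ‖v‖ ^ 2) := by
  rw [cGauss_eq_ofReal, Complex.norm_real, Real.norm_of_nonneg (exp_pos _).le]

lemma norm_coord_le (v : Eucl n) (i : Fin n) : ‖(v i : ℂ)‖ ≤ ‖v‖ := by
  rw [Complex.norm_real]; exact PiLp.norm_apply_le v i

/-- Functions dominated by `|v|^k exp (-b |v|²)` are integrable. -/
lemma integrable_of_le_gaussian {F : Type*} [NormedAddCommGroup F] (hn : n ≠ 0) {b : ℝ}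
    (hb : 0 < b) (k : ℕ) {f : Eucl n → F} (hf : Continuous f)
    (h : ∀ v, ‖f v‖ ≤ ‖v‖ ^ k * exp (-b * ‖v‖ ^ 2)) : Integrable f :=
  (integrable_norm_pow_mul_gaussian hn hb k).mono' hf.aestronglyMeasurable (ae_of_all _ h)

lemma hasDerivAt_fourier_line {f : Eucl n → ℂ} (hf : Integrable f)
    (hvf : Integrable (fun v => ‖v‖ * ‖f v‖)) (w : Eucl n) (i : Fin n) :
    HasDerivAt (fun s : ℝ => 𝓕 f (w + s • EuclideanSpace.single i (1 : ℝ)))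
      (-(2 * π * Complex.I) * 𝓕 (fun v : Eucl n => (v i : ℂ) * f v) w) 0 := by
  have h1 : HasDerivAt (fun s : ℝ => w + s • EuclideanSpace.single i (1 : ℝ))
      (EuclideanSpace.single i (1 : ℝ)) 0 := by
    simpa using ((hasDerivAt_id (0 : ℝ)).smul_const (EuclideanSpace.single i (1 : ℝ))).const_add w
  have h2 := Real.hasFDerivAt_fourier hf hvf w
  have h2' : HasFDerivAt (𝓕 f) (𝓕 (VectorFourier.fourierSMulRight (innerSL ℝ) f) w)
      (w + (0 : ℝ) • EuclideanSpace.single i (1 : ℝ)) := by simpa using h2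
  have h3 := h2'.comp_hasDerivAt (0 : ℝ) h1
  refine HasDerivAt.congr_deriv h3 ?_
  have hint : Integrable (fun v => 𝐞 (-⟪v, w⟫) •
      VectorFourier.fourierSMulRight (innerSL ℝ) f v) := by
    refine (Real.fourierIntegral_convergent_iff w).2 ?_
    refine Integrable.mono' (g := fun v => 2 * π * ‖innerSL ℝ (E := Eucl n)‖ * (‖v‖ * ‖f v‖))
      (hvf.const_mul _)
      hf.1.fourierSMulRight (ae_of_all _ fun v => ?_)
    refine (VectorFourier.norm_fourierSMulRight_le (innerSL ℝ) f v).trans (le_of_eq (by ring))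
  rw [Real.fourier_eq, Real.fourier_eq, ContinuousLinearMap.integral_apply hint,
    ← integral_const_mul]
  refine integral_congr_ae (ae_of_all _ fun v => ?_)
  have hs : (innerSL ℝ v) (EuclideanSpace.single i (1 : ℝ)) = v i := by
    change ⟪v, EuclideanSpace.single i (1 : ℝ)⟫ = v i
    simp [EuclideanSpace.inner_single_right]
  simp only [smul_eq_mul, Circle.smul_def, _root_.smul_apply,
    VectorFourier.fourierSMulRight_apply, Complex.real_smul]
  rw [show ∀ a : ℝ, a = v i → -(2 * π * Complex.I) * (𝐞 (-⟪v, w⟫) * ((v i : ℂ) * f v)) =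
    𝐞 (-⟪v, w⟫) * (-(2 * π * Complex.I) * ((a : ℂ) * f v)) from fun a ha => by rw [ha]; ring]
  exact hs

lemma norm_add_smul_single_sq (w : Eucl n) (i : Fin n) (s : ℝ) :
    ‖w + s • EuclideanSpace.single i (1 : ℝ)‖ ^ 2 = ‖w‖ ^ 2 + 2 * s * w i + s ^ 2 := by
  rw [norm_add_sq_real, inner_smul_right, EuclideanSpace.inner_single_right, norm_smul]
  simp
  ring

lemma fourier_cGauss {b : ℝ} (hb : 0 < b) (w : Eucl n) :
    𝓕 (cGauss b : Eucl n → ℂ) w = ((π / b : ℝ) ^ ((n : ℝ) / 2) : ℝ) * cGauss (π ^ 2 / b) w := by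
  have h := fourier_gaussian_innerProductSpace (V := Eucl n) (b := (b : ℂ)) (by simpa using hb) w
  unfold cGauss
  rw [h, Complex.ofReal_cpow (by positivity)]
  simp only [finrank_euclideanSpace, Fintype.card_fin]
  push_cast
  congr 2
  ring

lemma integrable_cGauss (hn : n ≠ 0) {b : ℝ} (hb : 0 < b) :
    Integrable (cGauss b : Eucl n → ℂ) :=
  integrable_of_le_gaussian hn hb 0 (continuous_cGauss b) fun v => by simp [norm_cGauss]

lemma continuous_coord_cGauss (b : ℝ) (i : Fin n) :
    Continuous (fun v : Eucl n => (v i : ℂ) * cGauss b v) := by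
  have := continuous_cGauss (n := n) b
  fun_prop

lemma hasDerivAt_cGauss_line (a : ℝ) (w : Eucl n) (i : Fin n) :
    HasDerivAt (fun s : ℝ => cGauss a (w + s • EuclideanSpace.single i (1 : ℝ)))
      (-(2 * a * w i : ℂ) * cGauss a w) 0 := by
  have h : ∀ s : ℝ, HasDerivAt (fun s : ℝ => exp (-a * (‖w‖ ^ 2 + 2 * s * w i + s ^ 2)))
      (exp (-a * (‖w‖ ^ 2 + 2 * s * w i + s ^ 2)) * (-a * (2 * w i + 2 * s))) s := by
    intro s
    have h1 : HasDerivAt (fun s : ℝ => ‖w‖ ^ 2 + 2 * s * w i + s ^ 2) (2 * w i + 2 * s) s := by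
      have h2 := (((hasDerivAt_id s).const_mul 2).mul_const (w i)).const_add (‖w‖ ^ 2)
      have h3 := h2.add ((hasDerivAt_id s).pow 2)
      refine h3.congr_deriv ?_
      simp
    exact (h1.const_mul (-a)).exp
  have h0 := (h 0).ofReal_comp
  simp only [mul_zero, zero_mul, add_zero, ne_eq, OfNat.ofNat_ne_zero, not_false_eq_true,
    zero_pow] at h0
  simp_rw [cGauss_eq_ofReal, norm_add_smul_single_sq]
  refine h0.congr_deriv ?_
  push_cast
  ring

lemma fourier_coord_cGauss (hn : n ≠ 0) {b : ℝ} (hb : 0 < b) (i : Fin n) (w : Eucl n) :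
    𝓕 (fun v : Eucl n => (v i : ℂ) * cGauss b v) w =
      ((π / b : ℝ) ^ ((n : ℝ) / 2) : ℝ) * ((π / b : ℝ) / Complex.I) *
        ((w i : ℂ) * cGauss (π ^ 2 / b) w) := by
  have h1 := hasDerivAt_fourier_line (integrable_cGauss hn hb)
    (integrable_of_le_gaussian hn hb 1 (by have := continuous_cGauss (n := n) b; fun_prop)
      fun v => by simp [norm_cGauss]) w i
  simp_rw [fourier_cGauss hb] at h1
  have h2 := (hasDerivAt_cGauss_line (π ^ 2 / b) w i).const_mul
    ((((π / b : ℝ) ^ ((n : ℝ) / 2) : ℝ)) : ℂ)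
  have h3 := h1.unique h2
  have hπ : (π : ℂ) ≠ 0 := by exact_mod_cast pi_ne_zero
  have hb' : (b : ℂ) ≠ 0 := by exact_mod_cast hb.ne'
  have h4 : -(2 * (π : ℂ) * Complex.I) ≠ 0 := by simp [hπ]
  refine mul_left_cancel₀ h4 (h3.trans ?_)
  push_cast
  field_simp [Complex.I_ne_zero]

lemma fourier_coord_sq_cGauss (hn : n ≠ 0) {b : ℝ} (hb : 0 < b) (i : Fin n) (w : Eucl n) :
    𝓕 (fun v : Eucl n => (v i : ℂ) * ((v i : ℂ) * cGauss b v)) w =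
      ((π / b : ℝ) ^ ((n : ℝ) / 2) : ℝ) * (1 / (2 * b) * (1 - 2 * (π ^ 2 / b) * (w i) ^ 2) *
        cGauss (π ^ 2 / b) w) := by
  have h1 := hasDerivAt_fourier_line (f := fun v : Eucl n => (v i : ℂ) * cGauss b v)
    (integrable_of_le_gaussian hn hb 1 (continuous_coord_cGauss b i) fun v => by
      rw [norm_mul, norm_cGauss, pow_one]; gcongr; exact norm_coord_le v i)
    (integrable_of_le_gaussian hn hb 2
      (continuous_norm.mul (continuous_coord_cGauss b i).norm) fun v => by
      rw [norm_mul, norm_norm, norm_norm, norm_mul, norm_cGauss, ← mul_assoc, pow_two]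
      gcongr; exact norm_coord_le v i) w i
  simp_rw [fourier_coord_cGauss hn hb] at h1
  have h5 : HasDerivAt (fun s : ℝ => (((w + s • EuclideanSpace.single i (1 : ℝ)) i : ℝ) : ℂ))
      1 0 := by
    have : HasDerivAt (fun s : ℝ => w i + s) 1 0 := (hasDerivAt_id (0 : ℝ)).const_add (w i)
    simpa using this.ofReal_comp
  have h2 := (h5.mul (hasDerivAt_cGauss_line (π ^ 2 / b) w i)).const_mul
    ((((π / b : ℝ) ^ ((n : ℝ) / 2) : ℝ) : ℂ) * ((π / b : ℝ) / Complex.I))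
  have h3 := h1.unique h2
  have hπ : (π : ℂ) ≠ 0 := by exact_mod_cast pi_ne_zero
  have hb' : (b : ℂ) ≠ 0 := by exact_mod_cast hb.ne'
  have h4 : -(2 * (π : ℂ) * Complex.I) ≠ 0 := by simp [hπ]
  refine mul_left_cancel₀ h4 (h3.trans ?_)
  simp only [zero_smul, add_zero]
  push_cast
  field_simp [Complex.I_ne_zero]
  rw [Complex.I_sq]
  ring

/-- The function whose Fourier transform is, up to a positive factor, `profile α t`. -/
def dualProfile [NeZero n] (α t : ℝ) (ξ : Eucl n) : ℝ :=
  quad α ξ * exp (-(π ^ 2 / t) * ‖ξ‖ ^ 2)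

/-- The factor between `profile α t` and the Fourier transform of `dualProfile α t`. -/
def profileFactor (n : ℕ) (t : ℝ) : ℝ := (t / π) ^ ((n : ℝ) / 2) * (t / (2 * π ^ 2))

lemma profileFactor_pos {t : ℝ} (ht : 0 < t) : 0 < profileFactor n t := by
  unfold profileFactor; positivity

lemma continuous_dualProfile [NeZero n] (α t : ℝ) :
    Continuous (dualProfile α t : Eucl n → ℝ) := by
  have := continuous_quad (n := n) α
  unfold dualProfile; fun_prop

lemma integrable_dualProfile [NeZero n] (α : ℝ) {t : ℝ} (ht : 0 < t) :
    Integrable (dualProfile α t : Eucl n → ℝ) := by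
  have hb : 0 < π ^ 2 / t := by positivity
  refine Integrable.mono'
    ((integrable_norm_pow_mul_gaussian (NeZero.ne n) hb 2).const_mul (|(n : ℝ) - 2 + α| + 2 * |α|))
    (continuous_dualProfile α t).aestronglyMeasurable (ae_of_all _ fun ξ => ?_)
  rw [dualProfile, norm_mul, Real.norm_of_nonneg (exp_pos _).le, ← mul_assoc, quad]
  gcongr
  refine (norm_sub_le _ _).trans ?_
  simp only [Real.norm_eq_abs, abs_mul, abs_pow, abs_norm, sq_abs, Nat.abs_ofNat]
  have := sq_coord_le ξ 0
  rw [add_mul]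
  gcongr

lemma fourier_dualProfile [NeZero n] (α : ℝ) {t : ℝ} (ht : 0 < t) (x : Eucl n) :
    𝓕 (fun ξ : Eucl n => (dualProfile α t ξ : ℂ)) x =
      ((profileFactor n t * profile α t x : ℝ) : ℂ) := by
  have hn : n ≠ 0 := NeZero.ne n
  have hb : 0 < π ^ 2 / t := by positivity
  -- the coefficients of the diagonal quadratic form
  set c : Fin n → ℂ := fun i => ((n : ℂ) - 2 + α) - if i = 0 then 2 * (α : ℂ) else 0 with hc
  have e : (fun ξ : Eucl n => (dualProfile α t ξ : ℂ)) = fun ξ =>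
      ∑ i, c i * ((ξ i : ℂ) * ((ξ i : ℂ) * cGauss (π ^ 2 / t) ξ)) := by
    ext ξ
    rw [dualProfile, quad, EuclideanSpace.real_norm_sq_eq, Complex.ofReal_mul,
      ← EuclideanSpace.real_norm_sq_eq, ← cGauss_eq_ofReal]
    simp only [hc, sub_mul, Finset.sum_sub_distrib, ite_mul, zero_mul, Finset.sum_ite_eq',
      Finset.mem_univ, if_true]
    rw [EuclideanSpace.real_norm_sq_eq]
    push_cast
    rw [sub_mul, Finset.mul_sum, Finset.sum_mul]
    congr 1
    · exact Finset.sum_congr rfl fun i _ => by ring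
    · ring
  have hint : ∀ i : Fin n, Integrable
      (fun ξ : Eucl n => (ξ i : ℂ) * ((ξ i : ℂ) * cGauss (π ^ 2 / t) ξ)) := fun i =>
    integrable_of_le_gaussian hn hb 2 (by have := continuous_coord_cGauss (n := n) (π ^ 2 / t) i
                                          fun_prop) fun v => by
      rw [norm_mul, norm_mul, norm_cGauss, ← mul_assoc]
      refine mul_le_mul_of_nonneg_right ?_ (exp_pos _).le
      rw [pow_two]
      gcongr <;> exact norm_coord_le v i
  have e2 : 𝓕 (fun ξ : Eucl n => ∑ i, c i * ((ξ i : ℂ) * ((ξ i : ℂ) * cGauss (π ^ 2 / t) ξ))) x =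
      ∑ i, c i * 𝓕 (fun ξ : Eucl n => (ξ i : ℂ) * ((ξ i : ℂ) * cGauss (π ^ 2 / t) ξ)) x := by
    simp_rw [Real.fourier_eq, Finset.smul_sum]
    rw [integral_finsetSum _ fun i _ =>
      (Real.fourierIntegral_convergent_iff x).2 ((hint i).const_mul (c i))]
    refine Finset.sum_congr rfl fun i _ => ?_
    rw [← integral_const_mul]
    refine integral_congr_ae (ae_of_all _ fun v => ?_)
    simp only [Circle.smul_def, smul_eq_mul]
    ring
  rw [e, e2]
  simp_rw [fourier_coord_sq_cGauss hn hb]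
  have e3 : π / (π ^ 2 / t) = t / π := by field_simp
  have e4 : π ^ 2 / (π ^ 2 / t) = t := by field_simp
  have hπ : (π : ℂ) ≠ 0 := by exact_mod_cast pi_ne_zero
  have ht' : (t : ℂ) ≠ 0 := by exact_mod_cast ht.ne'
  have e5 : ((π : ℂ) ^ 2 / ((π ^ 2 / t : ℝ) : ℂ)) = t := by
    rw [← e4]; push_cast; field_simp
  simp_rw [e3, e4, e5]
  have e6 : cGauss t x = ((exp (-(‖x‖ ^ 2 * t)) : ℝ) : ℂ) := by
    rw [cGauss_eq_ofReal]; congr 2; ring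
  rw [profile, profileFactor, quad, e6]
  generalize exp (-(‖x‖ ^ 2 * t)) = g
  generalize (t / π) ^ ((n : ℝ) / 2) = d
  have e7 : ∀ i, c i * ((d : ℂ) * (1 / (2 * ((π ^ 2 / t : ℝ) : ℂ)) * (1 - 2 * (t : ℂ) * (x i) ^ 2)
      * (g : ℂ))) = (d : ℂ) * (t / (2 * π ^ 2)) * g *
        (c i - 2 * t * (c i * (x i) ^ 2)) := by
    intro i; push_cast; field_simp
  simp_rw [e7]
  rw [← Finset.mul_sum, Finset.sum_sub_distrib, ← Finset.mul_sum]
  simp only [hc, sub_mul, Finset.sum_sub_distrib, ite_mul, zero_mul, Finset.sum_ite_eq',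
    Finset.mem_univ, if_true, Finset.sum_const, Finset.card_univ, Fintype.card_fin,
    ← Finset.mul_sum]
  rw [EuclideanSpace.real_norm_sq_eq]
  push_cast
  rw [nsmul_eq_mul]
  ring

/-! ### Positive definiteness -/

/-- Parseval's formula for the convolution of two finite measures with a Fourier transform. -/
lemma integral_fourier_sub (μ ν : Measure (Eucl n)) [IsFiniteMeasure μ] [IsFiniteMeasure ν]
    {g : Eucl n → ℂ} (hg : Integrable g) :
    ∫ p, 𝓕 g (p.1 - p.2) ∂(μ.prod ν) =
      ∫ ξ, g ξ * (conj (charFun μ ((2 * π) • ξ)) * charFun ν ((2 * π) • ξ)) := by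
  have hint : Integrable (fun q : (Eucl n × Eucl n) × Eucl n =>
      𝐞 (-⟪q.2, q.1.1 - q.1.2⟫) • g q.2) ((μ.prod ν).prod volume) := by
    have h0 : Integrable (fun q : (Eucl n × Eucl n) × Eucl n => (1 : ℂ) * g q.2)
        ((μ.prod ν).prod volume) := (integrable_const (1 : ℂ)).mul_prod hg
    simp only [one_mul] at h0
    refine (integrable_norm_iff ?_).1 (h0.norm.congr (ae_of_all _ fun q => by
      simp [Circle.norm_smul]))
    refine AEStronglyMeasurable.smul ?_ h0.1
    exact (Continuous.aestronglyMeasurable (by fun_prop))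
  simp_rw [Real.fourier_eq]
  rw [integral_integral_swap (f := fun (p : Eucl n × Eucl n) ξ => 𝐞 (-⟪ξ, p.1 - p.2⟫) • g ξ) hint]
  refine integral_congr_ae (ae_of_all _ fun ξ => ?_)
  simp only [Circle.smul_def, smul_eq_mul]
  rw [integral_mul_const, mul_comm]
  congr 1
  rw [← charFun_neg, charFun_apply, charFun_apply, ← integral_prod_mul]
  refine integral_congr_ae (ae_of_all _ fun p => ?_)
  simp only [Real.fourierChar_apply]
  rw [← Complex.exp_add]
  congr 1
  simp only [inner_sub_right, inner_neg_right, real_inner_smul_right, real_inner_comm ξ]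
  push_cast
  ring

lemma integrable_mul_charFun {μ ν : Measure (Eucl n)} [IsFiniteMeasure μ] [IsFiniteMeasure ν]
    {g : Eucl n → ℂ} (hg : Integrable g) :
    Integrable fun ξ => g ξ * (conj (charFun μ ((2 * π) • ξ)) * charFun ν ((2 * π) • ξ)) := by
  have h1 := continuous_charFun (μ := μ)
  have h2 := continuous_charFun (μ := ν)
  refine hg.mul_bdd (c := μ.real univ * ν.real univ) ?_ (ae_of_all _ fun ξ => ?_)
  · exact Continuous.aestronglyMeasurable (by fun_prop)
  · rw [norm_mul, RCLike.norm_conj]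
    gcongr <;> exact norm_charFun_le _

lemma integral_sub_sub_add {X : Type*} [MeasurableSpace X] {μ : Measure X} {F : Type*}
    [NormedAddCommGroup F] [NormedSpace ℝ F] {f₁ f₂ f₃ f₄ : X → F} (h₁ : Integrable f₁ μ)
    (h₂ : Integrable f₂ μ) (h₃ : Integrable f₃ μ) (h₄ : Integrable f₄ μ) :
    ∫ x, f₁ x ∂μ - ∫ x, f₂ x ∂μ - ∫ x, f₃ x ∂μ + ∫ x, f₄ x ∂μ =
      ∫ x, (f₁ x - f₂ x - f₃ x + f₄ x) ∂μ := by
  have h := integral_add ((h₁.sub h₂).sub h₃) h₄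
  rw [integral_sub' (h₁.sub h₂) h₃, integral_sub' h₁ h₂] at h
  exact h.symm

/-- A function with a real Fourier transform `k` defines a quadratic form on differences of finite
measures, which is diagonalised by the characteristic functions. -/
lemma integral_sub_eq_integral_charFun (μ ν : Measure (Eucl n)) [IsFiniteMeasure μ]
    [IsFiniteMeasure ν] {g k : Eucl n → ℝ} (hg : Integrable g)
    (hk : ∀ x, 𝓕 (fun ξ => (g ξ : ℂ)) x = k x) :
    ∫ p, k (p.1 - p.2) ∂(μ.prod μ) - ∫ p, k (p.1 - p.2) ∂(μ.prod ν)
      - ∫ p, k (p.1 - p.2) ∂(ν.prod μ) + ∫ p, k (p.1 - p.2) ∂(ν.prod ν) =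
    ∫ ξ, g ξ * ‖charFun μ ((2 * π) • ξ) - charFun ν ((2 * π) • ξ)‖ ^ 2 := by
  have hgC : Integrable (fun ξ => (g ξ : ℂ)) := hg.ofReal
  have h : ∀ (σ τ : Measure (Eucl n)) [IsFiniteMeasure σ] [IsFiniteMeasure τ],
      ((∫ p, k (p.1 - p.2) ∂(σ.prod τ) : ℝ) : ℂ) =
      ∫ ξ, (g ξ : ℂ) * (conj (charFun σ ((2 * π) • ξ)) * charFun τ ((2 * π) • ξ)) := by
    intro σ τ _ _
    rw [← integral_fourier_sub σ τ hgC, ← integral_complex_ofReal]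
    simp_rw [← hk]
  have hi : ∀ (σ τ : Measure (Eucl n)) [IsFiniteMeasure σ] [IsFiniteMeasure τ], Integrable
      fun ξ => (g ξ : ℂ) * (conj (charFun σ ((2 * π) • ξ)) * charFun τ ((2 * π) • ξ)) :=
    fun σ τ _ _ => integrable_mul_charFun hgC
  apply Complex.ofReal_injective
  push_cast
  rw [h, h, h, h, integral_sub_sub_add (hi μ μ) (hi μ ν) (hi ν μ) (hi ν ν),
    ← integral_complex_ofReal]
  refine integral_congr_ae (ae_of_all _ fun ξ => ?_)
  push_cast
  rw [← Complex.conj_mul', map_sub]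
  ring

lemma fourier_gaussian_real {t : ℝ} (ht : 0 < t) (x : Eucl n) :
    𝓕 (fun ξ : Eucl n =>
      ((((t / π) ^ ((n : ℝ) / 2))⁻¹ * exp (-(π ^ 2 / t) * ‖ξ‖ ^ 2) : ℝ) : ℂ)) x =
      ((exp (-(‖x‖ ^ 2 * t)) : ℝ) : ℂ) := by
  have hb : 0 < π ^ 2 / t := by positivity
  have h := fourier_cGauss (n := n) hb x
  have e3 : π / (π ^ 2 / t) = t / π := by field_simp
  have e4 : π ^ 2 / (π ^ 2 / t) = t := by field_simp
  rw [e3, e4, Real.fourier_eq] at h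
  have hd : (((t / π) ^ ((n : ℝ) / 2) : ℝ) : ℂ) ≠ 0 := by
    have : 0 < (t / π) ^ ((n : ℝ) / 2) := by positivity
    exact_mod_cast this.ne'
  rw [Real.fourier_eq]
  simp_rw [Complex.ofReal_mul, ← cGauss_eq_ofReal]
  calc ∫ v : Eucl n, 𝐞 (-⟪v, x⟫) •
        ((((t / π) ^ ((n : ℝ) / 2))⁻¹ : ℝ) * cGauss (π ^ 2 / t) v : ℂ)
      = ∫ v : Eucl n, ((((t / π) ^ ((n : ℝ) / 2))⁻¹ : ℝ) : ℂ) *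
          (𝐞 (-⟪v, x⟫) • cGauss (π ^ 2 / t) v) := by
        refine integral_congr_ae (ae_of_all _ fun v => ?_)
        simp only [Circle.smul_def, smul_eq_mul]
        ring
    _ = _ := by
        rw [integral_const_mul, h, cGauss_eq_ofReal]
        push_cast
        rw [inv_mul_cancel_left₀ (by exact_mod_cast hd)]
        congr 1; ring

/-- The Gaussian kernel is positive definite. -/
lemma gaussian_cross_le (μ ν : Measure (Eucl n)) [IsFiniteMeasure μ] [IsFiniteMeasure ν]
    (hn : n ≠ 0) {t : ℝ} (ht : 0 < t) :
    ∫⁻ p, ENNReal.ofReal (exp (-(‖p.1 - p.2‖ ^ 2 * t))) ∂(μ.prod ν) ≤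
      ∫⁻ p, ENNReal.ofReal (exp (-(‖p.1 - p.2‖ ^ 2 * t))) ∂(μ.prod μ) +
      ∫⁻ p, ENNReal.ofReal (exp (-(‖p.1 - p.2‖ ^ 2 * t))) ∂(ν.prod ν) := by
  have hb : 0 < π ^ 2 / t := by positivity
  have hg : Integrable (fun ξ : Eucl n =>
      ((t / π) ^ ((n : ℝ) / 2))⁻¹ * exp (-(π ^ 2 / t) * ‖ξ‖ ^ 2)) := by
    simpa using (integrable_norm_pow_mul_gaussian hn hb 0).const_mul _
  have h := integral_sub_eq_integral_charFun μ ν hg (fourier_gaussian_real ht)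
  have hpos : 0 ≤ ∫ ξ : Eucl n, ((t / π) ^ ((n : ℝ) / 2))⁻¹ * exp (-(π ^ 2 / t) * ‖ξ‖ ^ 2) *
      ‖charFun μ ((2 * π) • ξ) - charFun ν ((2 * π) • ξ)‖ ^ 2 :=
    integral_nonneg fun ξ => by positivity
  have hi : ∀ (σ τ : Measure (Eucl n)) [IsFiniteMeasure σ] [IsFiniteMeasure τ], Integrable
      (fun p : Eucl n × Eucl n => exp (-(‖p.1 - p.2‖ ^ 2 * t))) (σ.prod τ) := by
    intro σ τ _ _
    refine Integrable.mono' (integrable_const (1 : ℝ))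
      (Continuous.aestronglyMeasurable (by fun_prop)) (ae_of_all _ fun p => ?_)
    rw [Real.norm_of_nonneg (exp_pos _).le, exp_le_one_iff]
    have : 0 ≤ ‖p.1 - p.2‖ ^ 2 * t := by positivity
    linarith
  have h0 : ∀ (σ τ : Measure (Eucl n)),
      0 ≤ ∫ p, exp (-(‖p.1 - p.2‖ ^ 2 * t)) ∂(σ.prod τ) :=
    fun σ τ => integral_nonneg fun p => (exp_pos _).le
  have hl : ∀ (σ τ : Measure (Eucl n)) [IsFiniteMeasure σ] [IsFiniteMeasure τ],
      ∫⁻ p, ENNReal.ofReal (exp (-(‖p.1 - p.2‖ ^ 2 * t))) ∂(σ.prod τ) =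
        ENNReal.ofReal (∫ p, exp (-(‖p.1 - p.2‖ ^ 2 * t)) ∂(σ.prod τ)) := fun σ τ _ _ =>
    (ofReal_integral_eq_lintegral_ofReal (hi σ τ) (ae_of_all _ fun p => (exp_pos _).le)).symm
  rw [hl, hl, hl, ← ENNReal.ofReal_add (h0 _ _) (h0 _ _)]
  refine ENNReal.ofReal_le_ofReal ?_
  have := h0 ν μ
  linarith

/-- Positive definiteness of the Riesz kernel, integrated from that of the Gaussians. -/
lemma riesz_cross_le (μ ν : Measure (Eucl n)) [IsFiniteMeasure μ] [IsFiniteMeasure ν]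
    (hn : n ≠ 0) :
    ∫⁻ p, riesz (p.1 - p.2) ∂(μ.prod ν) ≤
      ∫⁻ p, riesz (p.1 - p.2) ∂(μ.prod μ) + ∫⁻ p, riesz (p.1 - p.2) ∂(ν.prod ν) := by
  have h : ∀ (σ τ : Measure (Eucl n)) [IsFiniteMeasure σ] [IsFiniteMeasure τ],
      ∫⁻ p, riesz (p.1 - p.2) ∂(σ.prod τ) =
      ∫⁻ t in Ioi (0 : ℝ), ENNReal.ofReal (t ^ ((n : ℝ) / 2 - 1 - 1)) *
        ∫⁻ p, ENNReal.ofReal (exp (-(‖p.1 - p.2‖ ^ 2 * t))) ∂(σ.prod τ) := by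
    intro σ τ _ _
    unfold riesz
    rw [lintegral_lintegral_swap (Measurable.aemeasurable (by fun_prop))]
    refine setLIntegral_congr_fun measurableSet_Ioi fun t ht => ?_
    have ht : (0 : ℝ) < t := ht
    rw [← lintegral_const_mul _ (by fun_prop)]
    refine lintegral_congr fun p => ?_
    rw [ENNReal.ofReal_mul (by positivity)]
  rw [h, h, h, ← lintegral_add_left]
  · refine setLIntegral_mono' measurableSet_Ioi fun t ht => ?_
    rw [← mul_add]
    gcongr
    exact gaussian_cross_le μ ν hn ht
  · refine Measurable.mul (by fun_prop) ?_
    exact Measurable.lintegral_prod_right' (f := fun q : ℝ × (Eucl n × Eucl n) =>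
      ENNReal.ofReal (exp (-(‖q.2.1 - q.2.2‖ ^ 2 * q.1)))) (by fun_prop)

/-! ### The mutual energy of two measures -/

/-- The mutual interaction energy `∬ W(x - y) dμ(x) dν(y)`, with values in `[0, ∞]`. -/
def mutualEnergy [NeZero n] (α : ℝ) (μ ν : Measure (Eucl n)) : ℝ≥0∞ :=
  ∫⁻ p, potential α (p.1 - p.2) ∂(μ.prod ν)

lemma measurable_potential_sub [NeZero n] (α : ℝ) :
    Measurable fun p : Eucl n × Eucl n => potential α (p.1 - p.2) :=
  (measurable_potential α).comp (by fun_prop)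

lemma potential_neg [NeZero n] (α : ℝ) (x : Eucl n) : potential α (-x) = potential α x := by
  simp [potential, interactionPotential]

lemma mutualEnergy_comm [NeZero n] (α : ℝ) (μ ν : Measure (Eucl n)) [SFinite μ] [SFinite ν] :
    mutualEnergy α μ ν = mutualEnergy α ν μ := by
  rw [mutualEnergy, ← lintegral_prod_swap]
  refine lintegral_congr fun p => ?_
  rw [← potential_neg α]
  simp

lemma mutualEnergy_lt_top [NeZero n] (hn : 3 ≤ n) {α : ℝ} (hα : -1 < α)
    {μ ν : Measure (Eucl n)} [IsFiniteMeasure μ] [IsFiniteMeasure ν]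
    (hμ : mutualEnergy α μ μ < ⊤) (hν : mutualEnergy α ν ν < ⊤) : mutualEnergy α μ ν < ⊤ := by
  obtain ⟨C, hC⟩ := potential_le_riesz hn α
  obtain ⟨D, hD⟩ := riesz_le_potential hn hα
  have h1 : ∀ σ : Measure (Eucl n), mutualEnergy α σ σ < ⊤ →
      ∫⁻ p, riesz (p.1 - p.2) ∂(σ.prod σ) < ⊤ := fun σ hσ => by
    calc ∫⁻ p, riesz (p.1 - p.2) ∂(σ.prod σ)
        ≤ ∫⁻ p, D * potential α (p.1 - p.2) ∂(σ.prod σ) := lintegral_mono fun p => hD _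
      _ = D * mutualEnergy α σ σ := lintegral_const_mul _ (measurable_potential_sub α)
      _ < ⊤ := ENNReal.mul_lt_top ENNReal.coe_lt_top hσ
  have hm : Measurable fun p : Eucl n × Eucl n => riesz (p.1 - p.2) :=
    measurable_riesz.comp (by fun_prop)
  calc mutualEnergy α μ ν
      ≤ ∫⁻ p, C * riesz (p.1 - p.2) ∂(μ.prod ν) := lintegral_mono fun p => hC _
    _ = C * ∫⁻ p, riesz (p.1 - p.2) ∂(μ.prod ν) := lintegral_const_mul _ hm
    _ < ⊤ := ENNReal.mul_lt_top ENNReal.coe_lt_top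
        ((riesz_cross_le μ ν (NeZero.ne n)).trans_lt
          (ENNReal.add_lt_top.2 ⟨h1 μ hμ, h1 ν hν⟩))

lemma integrable_profile_sub [NeZero n] (hn : 3 ≤ n) {α : ℝ} (hα : -1 < α)
    (hα' : α ≤ (n : ℝ) - 2) {μ ν : Measure (Eucl n)} [IsFiniteMeasure μ] [IsFiniteMeasure ν]
    (h : mutualEnergy α μ ν < ⊤) :
    Integrable (fun q : (Eucl n × Eucl n) × ℝ =>
      q.2 ^ ((n : ℝ) / 2 - 1 - 1) * profile α q.2 (q.1.1 - q.1.2))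
      ((μ.prod ν).prod (volume.restrict (Ioi 0))) := by
  have hm : Measurable (fun q : (Eucl n × Eucl n) × ℝ =>
      q.2 ^ ((n : ℝ) / 2 - 1 - 1) * profile α q.2 (q.1.1 - q.1.2)) := by
    refine Measurable.mul (by fun_prop) ?_
    exact (continuous_profile α).measurable.comp
      (g := fun p : ℝ × Eucl n => profile α p.1 p.2)
      (f := fun q : (Eucl n × Eucl n) × ℝ => (q.2, q.1.1 - q.1.2)) (by fun_prop)
  refine ⟨hm.aestronglyMeasurable, ?_⟩
  obtain ⟨C, hC⟩ := lintegral_profile_le_riesz (n := n) hn hα hα'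
  obtain ⟨D, hD⟩ := riesz_le_potential (n := n) hn hα
  rw [hasFiniteIntegral_iff_enorm, lintegral_prod _ hm.enorm.aemeasurable]
  calc _ ≤ ∫⁻ p, (C * D : ℝ≥0∞) * potential α (p.1 - p.2) ∂(μ.prod ν) := by
        refine lintegral_mono fun p => (hC (p.1 - p.2)).trans ?_
        rw [mul_assoc]
        gcongr
        exact hD _
    _ < ⊤ := by
        rw [lintegral_const_mul _ (measurable_potential_sub α)]
        exact ENNReal.mul_lt_top (ENNReal.mul_lt_top ENNReal.coe_lt_top ENNReal.coe_lt_top) h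

lemma toReal_mutualEnergy [NeZero n] (hn : 3 ≤ n) {α : ℝ} (hα : -1 < α)
    (hα' : α ≤ (n : ℝ) - 2) {μ ν : Measure (Eucl n)} [IsFiniteMeasure μ] [IsFiniteMeasure ν]
    (h : mutualEnergy α μ ν < ⊤) :
    4 * Gamma ((n : ℝ) / 2) * (mutualEnergy α μ ν).toReal =
      ∫ t in Ioi (0 : ℝ), t ^ ((n : ℝ) / 2 - 1 - 1) *
        ∫ p, profile α t (p.1 - p.2) ∂(μ.prod ν) := by
  have hfin := ae_lt_top (measurable_potential_sub α) h.ne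
  rw [mutualEnergy, ← integral_toReal (measurable_potential_sub α).aemeasurable hfin,
    ← integral_const_mul]
  have e : ∫ p, 4 * Gamma ((n : ℝ) / 2) * (potential α (p.1 - p.2)).toReal ∂(μ.prod ν) =
      ∫ p, (∫ t in Ioi (0 : ℝ), t ^ ((n : ℝ) / 2 - 1 - 1) * profile α t (p.1 - p.2))
        ∂(μ.prod ν) := by
    refine integral_congr_ae ?_
    filter_upwards [hfin] with p hp
    have hne : p.1 - p.2 ≠ 0 := fun h0 => by simp [h0] at hp
    rw [toReal_potential hn hα, integral_profile hn α hne]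
  rw [e, integral_integral_swap (f := fun (p : Eucl n × Eucl n) (t : ℝ) =>
    t ^ ((n : ℝ) / 2 - 1 - 1) * profile α t (p.1 - p.2)) (integrable_profile_sub hn hα hα' h)]
  simp_rw [integral_const_mul]

lemma integrableOn_integral_profile [NeZero n] (hn : 3 ≤ n) {α : ℝ} (hα : -1 < α)
    (hα' : α ≤ (n : ℝ) - 2) {μ ν : Measure (Eucl n)} [IsFiniteMeasure μ] [IsFiniteMeasure ν]
    (h : mutualEnergy α μ ν < ⊤) :
    IntegrableOn (fun t : ℝ => t ^ ((n : ℝ) / 2 - 1 - 1) *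
        ∫ p, profile α t (p.1 - p.2) ∂(μ.prod ν)) (Ioi 0) := by
  have := (integrable_profile_sub hn hα hα' h).integral_prod_right
  simp only [integral_const_mul] at this
  exact this

lemma ae_quad_pos [NeZero n] (hn : 3 ≤ n) {α : ℝ} (hα : -1 < α) (hα' : α ≤ (n : ℝ) - 2) :
    ∀ᵐ ξ : Eucl n, 0 < quad α ξ := by
  have h3 : (3 : ℝ) ≤ n := by exact_mod_cast hn
  let j : Fin n := ⟨1, by omega⟩
  have hj : (0 : Fin n) ≠ j := by
    intro h
    have := congrArg Fin.val h
    simp [j] at this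
  let S : Submodule ℝ (Eucl n) := LinearMap.ker (EuclideanSpace.proj (𝕜 := ℝ) j).toLinearMap
  have hS : S ≠ ⊤ := by
    intro h
    have : EuclideanSpace.single j (1 : ℝ) ∈ S := h ▸ Submodule.mem_top
    simp [S] at this
  have h0 : volume (S : Set (Eucl n)) = 0 := Measure.addHaar_submodule volume S hS
  filter_upwards [compl_mem_ae_iff.2 h0] with ξ hξ
  have hξj : ξ j ≠ 0 := fun h => hξ (by simp [S, h])
  have h1 : (ξ 0) ^ 2 + (ξ j) ^ 2 ≤ ‖ξ‖ ^ 2 := by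
    rw [EuclideanSpace.real_norm_sq_eq, ← Finset.sum_pair (f := fun i => (ξ i) ^ 2) hj]
    exact Finset.sum_le_sum_of_subset_of_nonneg (Finset.subset_univ _)
      fun i _ _ => by positivity
  have h2 : 0 < (ξ j) ^ 2 := by positivity
  have h4 : 0 ≤ (ξ 0) ^ 2 := by positivity
  unfold quad
  nlinarith

/-- The interaction energy is strictly positive definite on differences of finite measures of
finite energy. -/
lemma mutualEnergy_strict [NeZero n] (hn : 3 ≤ n) {α : ℝ} (hα : -1 < α)
    (hα' : α ≤ (n : ℝ) - 2) {μ ν : Measure (Eucl n)} [IsFiniteMeasure μ] [IsFiniteMeasure ν]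
    (hμ : mutualEnergy α μ μ < ⊤) (hν : mutualEnergy α ν ν < ⊤) (hne : μ ≠ ν) :
    2 * (mutualEnergy α μ ν).toReal <
      (mutualEnergy α μ μ).toReal + (mutualEnergy α ν ν).toReal := by
  have hμν := mutualEnergy_lt_top hn hα hμ hν
  have hνμ := mutualEnergy_lt_top hn hα hν hμ
  have h3 : (3 : ℝ) ≤ n := by exact_mod_cast hn
  have hG : 0 < 4 * Gamma ((n : ℝ) / 2) := by
    have := Gamma_pos_of_pos (show 0 < (n : ℝ) / 2 by linarith)
    positivity
  have i1 := integrableOn_integral_profile hn hα hα' hμ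
  have i2 := integrableOn_integral_profile hn hα hα' hμν
  have i3 := integrableOn_integral_profile hn hα hα' hνμ
  have i4 := integrableOn_integral_profile hn hα hα' hν
  have e := congrArg₂ (· + ·) (congrArg₂ (· - ·) (congrArg₂ (· - ·)
    (toReal_mutualEnergy hn hα hα' hμ) (toReal_mutualEnergy hn hα hα' hμν))
    (toReal_mutualEnergy hn hα hα' hνμ)) (toReal_mutualEnergy hn hα hα' hν)
  rw [integral_sub_sub_add i1 i2 i3 i4, mutualEnergy_comm α ν μ] at e
  suffices h : 0 < ∫ t in Ioi (0 : ℝ), (t ^ ((n : ℝ) / 2 - 1 - 1) * (profileFactor n t)⁻¹) *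
      ∫ ξ : Eucl n, dualProfile α t ξ *
        ‖charFun μ ((2 * π) • ξ) - charFun ν ((2 * π) • ξ)‖ ^ 2 by
    have e' : ∀ t ∈ Ioi (0 : ℝ), (t ^ ((n : ℝ) / 2 - 1 - 1) * (profileFactor n t)⁻¹) *
        ∫ ξ : Eucl n, dualProfile α t ξ *
          ‖charFun μ ((2 * π) • ξ) - charFun ν ((2 * π) • ξ)‖ ^ 2 =
        t ^ ((n : ℝ) / 2 - 1 - 1) * ∫ p, profile α t (p.1 - p.2) ∂(μ.prod μ)
        - t ^ ((n : ℝ) / 2 - 1 - 1) * ∫ p, profile α t (p.1 - p.2) ∂(μ.prod ν)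
        - t ^ ((n : ℝ) / 2 - 1 - 1) * ∫ p, profile α t (p.1 - p.2) ∂(ν.prod μ)
        + t ^ ((n : ℝ) / 2 - 1 - 1) * ∫ p, profile α t (p.1 - p.2) ∂(ν.prod ν) := by
      intro t ht
      have hc := profileFactor_pos (n := n) ht
      rw [← integral_sub_eq_integral_charFun μ ν (integrable_dualProfile α ht)
        (fourier_dualProfile α ht)]
      simp_rw [integral_const_mul]
      field_simp
    rw [setIntegral_congr_fun measurableSet_Ioi e'] at h
    rw [← e] at h
    by_contra hcon
    push Not at hcon
    nlinarith
  have hpos : ∀ t ∈ Ioi (0 : ℝ), 0 < (t ^ ((n : ℝ) / 2 - 1 - 1) * (profileFactor n t)⁻¹) *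
      ∫ ξ : Eucl n, dualProfile α t ξ *
        ‖charFun μ ((2 * π) • ξ) - charFun ν ((2 * π) • ξ)‖ ^ 2 := by
    intro t ht
    have ht' : (0 : ℝ) < t := ht
    have hc := profileFactor_pos (n := n) ht
    refine mul_pos (mul_pos (rpow_pos_of_pos ht' _) (inv_pos.2 hc)) ?_
    have h1 := continuous_charFun (μ := μ)
    have h2 := continuous_charFun (μ := ν)
    have hnn : ∀ ξ : Eucl n, 0 ≤ dualProfile α t ξ *
        ‖charFun μ ((2 * π) • ξ) - charFun ν ((2 * π) • ξ)‖ ^ 2 := fun ξ =>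
      mul_nonneg (mul_nonneg (quad_nonneg hn hα hα' ξ) (exp_pos _).le) (by positivity)
    refine lt_of_le_of_ne (integral_nonneg hnn) fun h0 => hne ?_
    have hint : Integrable (fun ξ : Eucl n => dualProfile α t ξ *
        ‖charFun μ ((2 * π) • ξ) - charFun ν ((2 * π) • ξ)‖ ^ 2) := by
      refine (integrable_dualProfile α ht).mul_bdd (c := (μ.real univ + ν.real univ) ^ 2)
        (Continuous.aestronglyMeasurable (by fun_prop)) (ae_of_all _ fun ξ => ?_)
      rw [norm_pow, norm_norm]
      gcongr
      exact (norm_sub_le _ _).trans (add_le_add (norm_charFun_le _) (norm_charFun_le _))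
    have hz := (integral_eq_zero_iff_of_nonneg hnn hint).1 h0.symm
    have hae : (fun ξ : Eucl n => charFun μ ((2 * π) • ξ)) =ᵐ[volume]
        fun ξ => charFun ν ((2 * π) • ξ) := by
      filter_upwards [hz, ae_quad_pos hn hα hα'] with ξ h5 h6
      have h7 : dualProfile α t ξ ≠ 0 := (mul_pos h6 (exp_pos _)).ne'
      have h8 := (mul_eq_zero.1 h5).resolve_left h7
      exact sub_eq_zero.1 (norm_eq_zero.1 (pow_eq_zero_iff two_ne_zero |>.1 h8))
    have heq := (Continuous.ae_eq_iff_eq volume (by fun_prop) (by fun_prop)).1 hae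
    refine Measure.ext_of_charFun (funext fun ξ => ?_)
    have := congrFun heq ((2 * π)⁻¹ • ξ)
    have h2π : 2 * π * (2 * π)⁻¹ = 1 := mul_inv_cancel₀ (by positivity)
    simpa only [smul_smul, h2π, one_smul] using this
  have hi : IntegrableOn (fun t : ℝ => (t ^ ((n : ℝ) / 2 - 1 - 1) * (profileFactor n t)⁻¹) *
      ∫ ξ : Eucl n, dualProfile α t ξ *
        ‖charFun μ ((2 * π) • ξ) - charFun ν ((2 * π) • ξ)‖ ^ 2) (Ioi 0) := by
    refine (((i1.sub i2).sub i3).add i4).congr ?_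
    filter_upwards [ae_restrict_mem measurableSet_Ioi] with t ht
    have hc := profileFactor_pos (n := n) ht
    rw [← integral_sub_eq_integral_charFun μ ν (integrable_dualProfile α ht)
      (fourier_dualProfile α ht)]
    simp only [integral_const_mul, Pi.sub_apply, Pi.add_apply]
    field_simp
  rw [setIntegral_pos_iff_support_of_nonneg_ae _ hi]
  · refine lt_of_lt_of_le ?_ (measure_mono (s := Ioi (0 : ℝ)) fun t ht => ⟨(hpos t ht).ne', ht⟩)
    simp
  · filter_upwards [ae_restrict_mem measurableSet_Ioi] with t ht using (hpos t ht).le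

/-! ### The energy and its strict convexity -/

/-- The second moment of a measure. -/
def secondMoment (μ : Measure (Eucl n)) : ℝ≥0∞ := ∫⁻ x, ‖x‖ₑ ^ 2 ∂μ

/-- The energy with values in `[0, ∞]`. -/
def totalEnergy [NeZero n] (α : ℝ) (μ : Measure (Eucl n)) : ℝ≥0∞ :=
  mutualEnergy α μ μ + secondMoment μ

lemma toENNReal_neg_interactionPotential [NeZero n] (hn : 3 ≤ n) {α : ℝ} (hα : -1 < α)
    (x : Eucl n) : (-interactionPotential α x).toENNReal = 0 := by
  rw [EReal.toENNReal_eq_zero_iff, EReal.neg_le, neg_zero]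
  exact interactionPotential_nonneg hn hα x

lemma interactionEnergy_eq [NeZero n] (hn : 3 ≤ n) {α : ℝ} (hα : -1 < α)
    (μ : Measure (Eucl n)) : interactionEnergy α μ = (mutualEnergy α μ μ : EReal) := by
  simp [interactionEnergy, extIntegral, toENNReal_neg_interactionPotential hn hα, mutualEnergy,
    potential]

lemma energy_eq [NeZero n] (hn : 3 ≤ n) {α : ℝ} (hα : -1 < α) (μ : Measure (Eucl n)) :
    energy α μ = (totalEnergy α μ : EReal) := by
  rw [energy, interactionEnergy_eq hn hα, totalEnergy, EReal.coe_ennreal_add, secondMoment]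

lemma energyWellDefined [NeZero n] (hn : 3 ≤ n) {α : ℝ} (hα : -1 < α) (μ : Measure (Eucl n)) :
    EnergyWellDefined α μ := by
  refine ⟨⟨((measurable_interactionPotential α).comp (by fun_prop)).aemeasurable, Or.inr ?_⟩, ?_⟩
  · simp [toENNReal_neg_interactionPotential hn hα]
  · rw [interactionEnergy_eq hn hα]
    exact EReal.coe_ennreal_ne_bot _

lemma mutualEnergy_smul_smul [NeZero n] (α : ℝ) (c d : ℝ≥0) (μ ν : Measure (Eucl n))
    [IsFiniteMeasure μ] [IsFiniteMeasure ν] :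
    mutualEnergy α (c • μ) (d • ν) = c * d * mutualEnergy α μ ν := by
  have h : ∀ (c : ℝ≥0) (μ ν : Measure (Eucl n)) [IsFiniteMeasure μ] [IsFiniteMeasure ν],
      mutualEnergy α (c • μ) ν = c * mutualEnergy α μ ν := by
    intro c μ ν _ _
    rw [mutualEnergy, Measure.prod_smul_left, lintegral_smul_measure, mutualEnergy,
      ENNReal.smul_def, smul_eq_mul]
  rw [h, mutualEnergy_comm, h, mutualEnergy_comm, mul_assoc]

lemma mutualEnergy_add_left [NeZero n] (α : ℝ) (μ μ' ν : Measure (Eucl n))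
    [IsFiniteMeasure μ] [IsFiniteMeasure μ'] [IsFiniteMeasure ν] :
    mutualEnergy α (μ + μ') ν = mutualEnergy α μ ν + mutualEnergy α μ' ν := by
  rw [mutualEnergy, Measure.add_prod, lintegral_add_measure, mutualEnergy, mutualEnergy]

lemma mutualEnergy_combination [NeZero n] (α : ℝ) (s t : ℝ≥0) (μ ν : Measure (Eucl n))
    [IsFiniteMeasure μ] [IsFiniteMeasure ν] :
    mutualEnergy α (s • μ + t • ν) (s • μ + t • ν) =
      s * s * mutualEnergy α μ μ + 2 * (s * t * mutualEnergy α μ ν)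
        + t * t * mutualEnergy α ν ν := by
  rw [mutualEnergy_add_left, mutualEnergy_comm α (s • μ), mutualEnergy_comm α (t • ν),
    mutualEnergy_add_left, mutualEnergy_add_left, mutualEnergy_comm α (t • ν) (s • μ)]
  simp_rw [mutualEnergy_smul_smul]
  ring

lemma secondMoment_smul (c : ℝ≥0) (μ : Measure (Eucl n)) :
    secondMoment (c • μ) = c * secondMoment μ := by
  rw [secondMoment, lintegral_smul_measure, secondMoment, ENNReal.smul_def, smul_eq_mul]

lemma secondMoment_combination (s t : ℝ≥0) (μ ν : Measure (Eucl n)) :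
    secondMoment (s • μ + t • ν) = s * secondMoment μ + t * secondMoment ν := by
  rw [← secondMoment_smul, ← secondMoment_smul, secondMoment, lintegral_add_measure]
  rfl

/-- Strict convexity of the energy on all measures of finite energy; compact support plays no role
here. -/
lemma totalEnergy_strictConvex [NeZero n] (hn : 3 ≤ n) {α : ℝ} (hα : -1 < α)
    (hα' : α ≤ (n : ℝ) - 2) {μ ν : Measure (Eucl n)} [IsFiniteMeasure μ]
    [IsFiniteMeasure ν] (hμ : totalEnergy α μ < ⊤) (hν : totalEnergy α ν < ⊤) (hne : μ ≠ ν)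
    {s t : ℝ≥0} (hs : 0 < s) (ht : 0 < t) (hst : s + t = 1) :
    totalEnergy α (s • μ + t • ν) < s * totalEnergy α μ + t * totalEnergy α ν := by
  unfold totalEnergy at *
  rw [ENNReal.add_lt_top] at hμ hν
  have hc := mutualEnergy_lt_top hn hα hμ.1 hν.1
  have hlt := mutualEnergy_strict hn hα hα' hμ.1 hν.1 hne
  rw [mutualEnergy_combination, secondMoment_combination]
  obtain ⟨h1, h2⟩ := hμ
  obtain ⟨h3, h4⟩ := hν
  generalize mutualEnergy α μ μ = a at *
  generalize mutualEnergy α ν ν = b at *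
  generalize mutualEnergy α μ ν = c at *
  generalize secondMoment μ = d at *
  generalize secondMoment ν = e at *
  lift a to ℝ≥0 using h1.ne
  lift b to ℝ≥0 using h3.ne
  lift c to ℝ≥0 using hc.ne
  lift d to ℝ≥0 using h2.ne
  lift e to ℝ≥0 using h4.ne
  norm_cast
  rw [← NNReal.coe_lt_coe]
  have hst' : (s : ℝ) + t = 1 := by exact_mod_cast hst
  have hs' : (0 : ℝ) < s := by exact_mod_cast hs
  have ht' : (0 : ℝ) < t := by exact_mod_cast ht
  simp only [ENNReal.coe_toReal] at hlt
  push_cast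
  have h5 := mul_lt_mul_of_pos_left hlt (mul_pos hs' ht')
  have h6 : (s : ℝ) = 1 - t := by linarith
  rw [h6] at h5 ⊢
  nlinarith

lemma support_smul_subset (c : ℝ≥0) (μ : Measure (Eucl n)) : (c • μ).support ⊆ μ.support :=
  Measure.AbsolutelyContinuous.support_mono (Measure.smul_absolutelyContinuous (c := c))

lemma secondMoment_lt_top_of_isCompact_support {μ : Measure (Eucl n)} [IsFiniteMeasure μ]
    (h : IsCompact μ.support) : secondMoment μ < ⊤ := by
  obtain ⟨R, hR⟩ := h.isBounded.exists_norm_le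
  have hae : ∀ᵐ x ∂μ, x ∈ μ.support := Measure.support_mem_ae
  calc secondMoment μ ≤ ∫⁻ _, ENNReal.ofReal R ^ 2 ∂μ := by
        refine lintegral_mono_ae ?_
        filter_upwards [hae] with x hx
        gcongr
        rw [← ofReal_norm]
        exact ENNReal.ofReal_le_ofReal (hR x hx)
    _ < ⊤ := by
        rw [lintegral_const]
        exact ENNReal.mul_lt_top (ENNReal.pow_lt_top ENNReal.ofReal_lt_top) (measure_lt_top _ _)

lemma mem_compactFiniteEnergyClass_iff [NeZero n] (hn : 3 ≤ n) {α : ℝ} (hα : -1 < α)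
    (μ : Measure (Eucl n)) : μ ∈ compactFiniteEnergyClass n α ↔
      IsProbabilityMeasure μ ∧ IsCompact μ.support ∧ mutualEnergy α μ μ < ⊤ := by
  rw [compactFiniteEnergyClass, mem_ofPred_eq, interactionEnergy_eq hn hα,
    ← EReal.coe_ennreal_top, EReal.coe_ennreal_lt_coe_ennreal_iff]

lemma totalEnergy_lt_top_of_mem [NeZero n] (hn : 3 ≤ n) {α : ℝ} (hα : -1 < α)
    {μ : Measure (Eucl n)} (h : μ ∈ compactFiniteEnergyClass n α) : totalEnergy α μ < ⊤ := by
  obtain ⟨_, h1, h2⟩ := (mem_compactFiniteEnergyClass_iff hn hα μ).1 h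
  exact ENNReal.add_lt_top.2 ⟨h2, secondMoment_lt_top_of_isCompact_support h1⟩

lemma isProbabilityMeasure_combination {s t : ℝ≥0} (hst : s + t = 1) (μ ν : Measure (Eucl n))
    [IsProbabilityMeasure μ] [IsProbabilityMeasure ν] :
    IsProbabilityMeasure (s • μ + t • ν) := by
  refine ⟨?_⟩
  rw [Measure.add_apply, Measure.smul_apply, Measure.smul_apply, measure_univ, measure_univ,
    ENNReal.smul_def, ENNReal.smul_def, smul_eq_mul, smul_eq_mul, mul_one, mul_one]
  exact_mod_cast hst

lemma convex_compactFiniteEnergyClass [NeZero n] (hn : 3 ≤ n) {α : ℝ} (hα : -1 < α) :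
    Convex ℝ≥0 (compactFiniteEnergyClass n α) := by
  intro μ hμ ν hν s t _ _ hst
  obtain ⟨_, h1, h2⟩ := (mem_compactFiniteEnergyClass_iff hn hα μ).1 hμ
  obtain ⟨_, h3, h4⟩ := (mem_compactFiniteEnergyClass_iff hn hα ν).1 hν
  refine (mem_compactFiniteEnergyClass_iff hn hα _).2
    ⟨isProbabilityMeasure_combination hst μ ν, ?_, ?_⟩
  · refine (h1.union h3).of_isClosed_subset Measure.isClosed_support ?_
    rw [Measure.support_add]
    exact union_subset_union (support_smul_subset s μ) (support_smul_subset t ν)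
  · rw [mutualEnergy_combination]
    have h5 := mutualEnergy_lt_top hn hα h2 h4
    have hs := ENNReal.coe_lt_top (r := s)
    have ht := ENNReal.coe_lt_top (r := t)
    have : (2 : ℝ≥0∞) < ⊤ := by simp
    refine ENNReal.add_lt_top.2 ⟨ENNReal.add_lt_top.2 ⟨?_, ?_⟩, ?_⟩
    · exact ENNReal.mul_lt_top (ENNReal.mul_lt_top hs hs) h2
    · exact ENNReal.mul_lt_top this (ENNReal.mul_lt_top (ENNReal.mul_lt_top hs ht) h5)
    · exact ENNReal.mul_lt_top (ENNReal.mul_lt_top ht ht) h4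

lemma energy_lt_of_totalEnergy_lt [NeZero n] (hn : 3 ≤ n) {α : ℝ} (hα : -1 < α)
    {μ ν ρ : Measure (Eucl n)} {s t : ℝ≥0}
    (h : totalEnergy α ρ < s * totalEnergy α μ + t * totalEnergy α ν) :
    energy α ρ < ((s : ℝ) : EReal) * energy α μ + ((t : ℝ) : EReal) * energy α ν := by
  rw [energy_eq hn hα, energy_eq hn hα, energy_eq hn hα, ← EReal.coe_nnreal_eq_coe_real,
    ← EReal.coe_nnreal_eq_coe_real, ← EReal.coe_ennreal_mul, ← EReal.coe_ennreal_mul,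
    ← EReal.coe_ennreal_add]
  exact EReal.coe_ennreal_lt_coe_ennreal_iff.2 h

/-! ### A measure of finite energy -/

lemma ae_ne_zero (hn : n ≠ 0) : ∀ᵐ x : Eucl n, x ≠ 0 := by
  have : NeZero n := ⟨hn⟩
  have h : (volume : Measure (Eucl n)) {0} = 0 := measure_singleton 0
  filter_upwards [compl_mem_ae_iff.2 h] with x hx using hx

lemma integrableOn_one_div_norm_pow {k : ℕ} (hk : k < n) (r : ℝ) :
    IntegrableOn (fun x : Eucl n => 1 / ‖x‖ ^ k) (Metric.ball 0 r) := by
  have : NeZero n := ⟨by omega⟩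
  refine (integrableOn_fun_norm_addHaar (volume : Measure (Eucl n))
    (f := fun y => 1 / y ^ k)).2 ?_
  have h : IntegrableOn (fun y : ℝ => y ^ (n - 1 - k)) (Ioo 0 r) :=
    ((by fun_prop : Continuous fun y : ℝ => y ^ (n - 1 - k)).integrableOn_Icc).mono_set
      Ioo_subset_Icc_self
  refine h.congr_fun (fun y hy => ?_) measurableSet_Ioo
  have hy : y ≠ 0 := hy.1.ne'
  simp only [finrank_euclideanSpace, Fintype.card_fin, smul_eq_mul]
  rw [show n - 1 = n - 1 - k + k by omega, pow_add]
  simp [hy]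

lemma lintegral_riesz_ball_lt_top (hn : 3 ≤ n) (r : ℝ) :
    ∫⁻ x in Metric.ball (0 : Eucl n) r, riesz x < ⊤ := by
  have hi : IntegrableOn
      (fun x : Eucl n => 1 / ‖x‖ ^ (n - 2) * Gamma ((n : ℝ) / 2 - 1)) (Metric.ball 0 r) :=
    (integrableOn_one_div_norm_pow (by omega) r).mul_const _
  calc ∫⁻ x in Metric.ball (0 : Eucl n) r, riesz x
      = ∫⁻ x in Metric.ball (0 : Eucl n) r,
          ENNReal.ofReal (1 / ‖x‖ ^ (n - 2) * Gamma ((n : ℝ) / 2 - 1)) := by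
        refine lintegral_congr_ae ?_
        filter_upwards [ae_restrict_of_ae (ae_ne_zero (by omega))] with x hx
        exact riesz_of_ne hn hx
    _ < ⊤ := hi.lintegral_lt_top

lemma riesz_le_of_one_le (hn : 3 ≤ n) {x : Eucl n} (hx : 1 ≤ ‖x‖) :
    riesz x ≤ ENNReal.ofReal (Gamma ((n : ℝ) / 2 - 1)) := by
  have hG := Gamma_pos_of_pos (half_dim_sub_one_pos hn)
  rw [riesz_of_ne hn (norm_pos_iff.1 (by linarith))]
  refine ENNReal.ofReal_le_ofReal (mul_le_of_le_one_left hG.le ?_)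
  exact div_le_one_of_le₀ (one_le_pow₀ hx) (by positivity)

lemma riesz_le_indicator_add (hn : 3 ≤ n) (x : Eucl n) :
    riesz x ≤ (Metric.ball (0 : Eucl n) 1).indicator riesz x
      + ENNReal.ofReal (Gamma ((n : ℝ) / 2 - 1)) := by
  by_cases hx : x ∈ Metric.ball (0 : Eucl n) 1
  · rw [indicator_of_mem hx]; exact le_self_add
  · rw [indicator_of_notMem hx, zero_add]
    exact riesz_le_of_one_le hn (by simpa using hx)

lemma mutualEnergy_ball_lt_top [NeZero n] (hn : 3 ≤ n) (α : ℝ) :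
    mutualEnergy α (volume.restrict (Metric.ball (0 : Eucl n) 1))
      (volume.restrict (Metric.ball 0 1)) < ⊤ := by
  obtain ⟨C, hC⟩ := potential_le_riesz hn α
  have hV : volume (Metric.ball (0 : Eucl n) 1) < ⊤ := measure_ball_lt_top
  set K : ℝ≥0∞ := ∫⁻ x in Metric.ball (0 : Eucl n) 1, riesz x
  set G : ℝ≥0∞ := ENNReal.ofReal (Gamma ((n : ℝ) / 2 - 1))
  have hK : K < ⊤ := lintegral_riesz_ball_lt_top hn 1
  have hi : Measurable ((Metric.ball (0 : Eucl n) 1).indicator riesz) :=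
    measurable_riesz.indicator Metric.isOpen_ball.measurableSet
  have hb : ∀ x : Eucl n, ∫⁻ y in Metric.ball (0 : Eucl n) 1, potential α (x - y) ≤
      C * (K + G * volume (Metric.ball (0 : Eucl n) 1)) := fun x =>
    calc ∫⁻ y in Metric.ball (0 : Eucl n) 1, potential α (x - y)
        ≤ ∫⁻ y in Metric.ball (0 : Eucl n) 1,
            C * ((Metric.ball (0 : Eucl n) 1).indicator riesz (x - y) + G) := by
          refine lintegral_mono fun y => (hC _).trans ?_
          gcongr
          exact riesz_le_indicator_add hn _
      _ = C * ((∫⁻ y in Metric.ball (0 : Eucl n) 1,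
            (Metric.ball (0 : Eucl n) 1).indicator riesz (x - y))
            + G * volume (Metric.ball (0 : Eucl n) 1)) := by
          have hi' : Measurable fun y => (Metric.ball (0 : Eucl n) 1).indicator riesz (x - y) :=
            hi.comp (by fun_prop)
          rw [lintegral_const_mul _ (hi'.add_const _), lintegral_add_left hi', setLIntegral_const]
      _ ≤ C * (K + G * volume (Metric.ball (0 : Eucl n) 1)) := by
          gcongr
          refine (setLIntegral_le_lintegral (Metric.ball (0 : Eucl n) 1)
            (fun y => (Metric.ball (0 : Eucl n) 1).indicator riesz (x - y))).trans_eq ?_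
          rw [lintegral_sub_left_eq_self (fun z => (Metric.ball (0 : Eucl n) 1).indicator riesz z),
            lintegral_indicator Metric.isOpen_ball.measurableSet]
  rw [mutualEnergy, lintegral_prod _ (measurable_potential_sub α).aemeasurable]
  calc _ ≤ ∫⁻ _ in Metric.ball (0 : Eucl n) 1,
          C * (K + G * volume (Metric.ball (0 : Eucl n) 1)) := lintegral_mono hb
    _ < ⊤ := by
        rw [setLIntegral_const]
        exact ENNReal.mul_lt_top (ENNReal.mul_lt_top ENNReal.coe_lt_top
          (ENNReal.add_lt_top.2 ⟨hK, ENNReal.mul_lt_top ENNReal.ofReal_lt_top hV⟩)) hV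

/-- The uniform measure on the unit ball has finite energy. -/
lemma exists_totalEnergy_lt_top [NeZero n] (hn : 3 ≤ n) (α : ℝ) :
    ∃ μ : ProbabilityMeasure (Eucl n), totalEnergy α (μ : Measure (Eucl n)) < ⊤ := by
  set B := Metric.ball (0 : Eucl n) 1
  have hV : volume B ≠ ⊤ := measure_ball_lt_top.ne
  have hV0 : volume B ≠ 0 := (Metric.measure_ball_pos volume 0 one_pos).ne'
  have : IsFiniteMeasure (volume.restrict B) := ⟨by simpa using hV.lt_top⟩
  set c : ℝ≥0 := (volume B).toNNReal⁻¹
  have hp : IsProbabilityMeasure (c • volume.restrict B) := by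
    refine ⟨?_⟩
    rw [Measure.smul_apply, Measure.restrict_apply_univ, ENNReal.smul_def, smul_eq_mul,
      ENNReal.coe_inv (by simp [ENNReal.toNNReal_eq_zero_iff, hV, hV0]), ENNReal.coe_toNNReal hV,
      ENNReal.inv_mul_cancel hV0 hV]
  refine ⟨⟨c • volume.restrict B, hp⟩, ?_⟩
  simp only [ProbabilityMeasure.coe_mk, totalEnergy, mutualEnergy_smul_smul, secondMoment_smul]
  refine ENNReal.add_lt_top.2 ⟨ENNReal.mul_lt_top (ENNReal.mul_lt_top ENNReal.coe_lt_top
    ENNReal.coe_lt_top) (mutualEnergy_ball_lt_top hn α), ENNReal.mul_lt_top ENNReal.coe_lt_top ?_⟩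
  calc secondMoment (volume.restrict B) ≤ ∫⁻ _ in B, 1 := by
        refine setLIntegral_mono' Metric.isOpen_ball.measurableSet fun x hx => ?_
        have : ‖x‖ₑ ≤ 1 := by
          rw [← ofReal_norm, ← ENNReal.ofReal_one]
          exact ENNReal.ofReal_le_ofReal (by simpa [B] using (mem_ball_zero_iff.1 hx).le)
        exact pow_le_one₀ zero_le this
    _ < ⊤ := by rw [setLIntegral_const, one_mul]; exact hV.lt_top

/-! ### Existence of a minimiser -/

/-- The integral of a nonnegative continuous function is lower semicontinuous for the weak
convergence of probability measures. -/
lemma lowerSemicontinuous_lintegral {X : Type*} [TopologicalSpace X] [MeasurableSpace X]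
    [OpensMeasurableSpace X] {f : X → ℝ≥0∞} (hf : Continuous f) :
    LowerSemicontinuous fun μ : ProbabilityMeasure X => ∫⁻ x, f x ∂(μ : Measure X) := by
  have hfin : ∀ (k : ℕ) x, min (f x) k ≠ ⊤ := fun k x =>
    ((min_le_right _ _).trans_lt (ENNReal.natCast_lt_top k)).ne
  -- bounded continuous truncations, increasing to `f`
  let g : ℕ → BoundedContinuousFunction X ℝ≥0 := fun k =>
    BoundedContinuousFunction.mkOfBound
      ⟨fun x => (min (f x) k).toNNReal, ENNReal.continuousOn_toNNReal.comp_continuous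
        (by fun_prop) (hfin k)⟩ k fun x y => by
      have h : ∀ x, ((min (f x) k).toNNReal : ℝ) ≤ k := fun x => by
        have := ENNReal.toNNReal_mono (ENNReal.natCast_ne_top k) (min_le_right (f x) k)
        exact_mod_cast this
      rw [NNReal.dist_eq]
      exact abs_sub_le_of_nonneg_of_le (NNReal.coe_nonneg _) (h x) (NNReal.coe_nonneg _) (h y)
  have hg : ∀ k x, (g k x : ℝ≥0∞) = min (f x) k := fun k x => ENNReal.coe_toNNReal (hfin k x)
  have e : (fun μ : ProbabilityMeasure X => ∫⁻ x, f x ∂(μ : Measure X)) =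
      fun μ : ProbabilityMeasure X => ⨆ k, ∫⁻ x, g k x ∂(μ : Measure X) := by
    ext μ
    rw [← lintegral_iSup]
    · refine lintegral_congr fun x => ?_
      simp_rw [hg]
      rw [← inf_iSup_eq, ENNReal.iSup_natCast, inf_top_eq]
    · exact fun k => (g k).measurable_coe_ennreal_comp
    · intro k l hkl x
      simp only [hg]
      gcongr
  rw [e]
  exact lowerSemicontinuous_iSup fun k =>
    (ProbabilityMeasure.continuous_lintegral_boundedContinuousFunction (g k)).lowerSemicontinuous

lemma continuous_potential [NeZero n] (hn : 3 ≤ n) {α : ℝ} (hα : -1 < α) :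
    Continuous (potential α : Eucl n → ℝ≥0∞) := by
  rw [continuous_iff_continuousAt]
  intro x
  by_cases hx : x = 0
  · rw [hx, continuousAt_iff_punctured_nhds, potential_zero]
    have hm : 0 < min 1 (1 + α) := lt_min zero_lt_one (by linarith)
    have h1 : Tendsto (fun x : Eucl n => ‖x‖ ^ (n - 2)) (𝓝[≠] 0) (𝓝[>] 0) := by
      refine tendsto_nhdsWithin_iff.2 ⟨?_, ?_⟩
      · have : Tendsto (fun x : Eucl n => ‖x‖ ^ (n - 2)) (𝓝 0) (𝓝 (‖(0 : Eucl n)‖ ^ (n - 2))) :=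
          Continuous.tendsto (by fun_prop) 0
        rw [norm_zero, zero_pow (by omega)] at this
        exact this.mono_left nhdsWithin_le_nhds
      · filter_upwards [self_mem_nhdsWithin] with x hx
        exact pow_pos (norm_pos_iff.2 hx) _
    have h2 : Tendsto (fun x : Eucl n => min 1 (1 + α) / ‖x‖ ^ (n - 2)) (𝓝[≠] 0) atTop := by
      simp_rw [div_eq_mul_inv]
      exact (tendsto_inv_nhdsGT_zero.comp h1).const_mul_atTop hm
    refine tendsto_nhds_top_mono (ENNReal.tendsto_ofReal_atTop.comp h2) ?_
    filter_upwards [self_mem_nhdsWithin] with x hx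
    rw [potential_of_ne α hx]
    exact ENNReal.ofReal_le_ofReal (le_realPotential hn α hx)
  · have h1 : ContinuousAt (fun y : Eucl n => ENNReal.ofReal (realPotential α y)) x := by
      refine ENNReal.continuous_ofReal.continuousAt.comp ?_
      have h : ‖x‖ ≠ 0 := norm_ne_zero_iff.2 hx
      unfold realPotential
      have h2 : ‖x‖ ^ (n - 2) ≠ 0 := pow_ne_zero _ h
      have h3 : ‖x‖ ^ n ≠ 0 := pow_ne_zero _ h
      fun_prop (disch := assumption)
    refine h1.congr ?_
    filter_upwards [isOpen_ne.mem_nhds hx] with y hy using (potential_of_ne α hy).symm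

lemma lowerSemicontinuous_totalEnergy [NeZero n] (hn : 3 ≤ n) {α : ℝ} (hα : -1 < α) :
    LowerSemicontinuous fun μ : ProbabilityMeasure (Eucl n) =>
      totalEnergy α (μ : Measure (Eucl n)) := by
  have hd : Continuous fun μ : ProbabilityMeasure (Eucl n) => μ.prod μ :=
    ProbabilityMeasure.continuous_prod.comp (continuous_id.prodMk continuous_id)
  have hW : Continuous fun p : Eucl n × Eucl n => potential α (p.1 - p.2) :=
    (continuous_potential hn hα).comp (continuous_fst.sub continuous_snd)
  have h1 : LowerSemicontinuous fun μ : ProbabilityMeasure (Eucl n) =>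
      mutualEnergy α (μ : Measure (Eucl n)) μ :=
    (lowerSemicontinuous_lintegral hW).comp hd
  have h2 : LowerSemicontinuous fun μ : ProbabilityMeasure (Eucl n) =>
      secondMoment (μ : Measure (Eucl n)) :=
    lowerSemicontinuous_lintegral (by fun_prop)
  exact h1.add h2

lemma sq_mul_measure_compl_closedBall_le (μ : Measure (Eucl n)) {R : ℝ} (hR : 0 ≤ R) :
    ENNReal.ofReal (R ^ 2) * μ (Metric.closedBall 0 R)ᶜ ≤
      ∫⁻ x in (Metric.closedBall 0 R)ᶜ, ‖x‖ₑ ^ 2 ∂μ := by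
  rw [← setLIntegral_const]
  refine setLIntegral_mono' Metric.isClosed_closedBall.measurableSet.compl fun x hx => ?_
  rw [ENNReal.ofReal_pow hR, ← ofReal_norm]
  gcongr
  simpa using (not_le.1 (by simpa using hx : ¬ ‖x‖ ≤ R)).le

lemma sq_mul_measure_compl_closedBall_le_totalEnergy [NeZero n] (α : ℝ) (μ : Measure (Eucl n))
    {R : ℝ} (hR : 0 ≤ R) :
    ENNReal.ofReal (R ^ 2) * μ (Metric.closedBall 0 R)ᶜ ≤ totalEnergy α μ :=
  (sq_mul_measure_compl_closedBall_le μ hR).trans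
    ((setLIntegral_le_lintegral _ _).trans le_add_self)

lemma exists_minimiser [NeZero n] (hn : 3 ≤ n) {α : ℝ} (hα : -1 < α) :
    ∃ μ : ProbabilityMeasure (Eucl n), ∀ ν : ProbabilityMeasure (Eucl n),
      totalEnergy α (μ : Measure (Eucl n)) ≤ totalEnergy α (ν : Measure (Eucl n)) := by
  obtain ⟨σ, hσ⟩ := exists_totalEnergy_lt_top (n := n) hn α
  set c : ℝ≥0 := (totalEnergy α (σ : Measure (Eucl n))).toNNReal with hc
  have hc' : (c : ℝ≥0∞) = totalEnergy α (σ : Measure (Eucl n)) := ENNReal.coe_toNNReal hσ.ne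
  let u : ℕ → ℝ≥0 := fun k => c / ((k : ℝ≥0) + 1) ^ 2
  let K : ℕ → Set (Eucl n) := fun k => Metric.closedBall 0 ((k : ℝ) + 1)
  have hu : Tendsto u atTop (𝓝 0) := by
    have h1 : Tendsto (fun k : ℕ => ((k : ℝ≥0) + 1) ^ 2) atTop atTop := by
      refine tendsto_atTop_mono (fun k => ?_) (tendsto_natCast_atTop_atTop (R := ℝ≥0))
      exact (le_self_add (a := (k : ℝ≥0)) (b := 1)).trans (le_self_pow₀ (by simp) two_ne_zero)
    have h2 : Tendsto (fun k : ℕ => c * (((k : ℝ≥0) + 1) ^ 2)⁻¹) atTop (𝓝 (c * 0)) :=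
      (tendsto_inv_atTop_zero.comp h1).const_mul c
    rw [mul_zero] at h2
    exact h2.congr fun k => (div_eq_mul_inv _ _).symm
  have hK : IsCompact {μ : ProbabilityMeasure (Eucl n) | ∀ k, μ (K k)ᶜ ≤ u k} :=
    isCompact_setOfPred_probabilityMeasure_mass_eq_compl_isCompact_le hu
      (fun k => isCompact_closedBall 0 _) (Or.inl inferInstance)
  have hmem : ∀ ν : ProbabilityMeasure (Eucl n), totalEnergy α (ν : Measure (Eucl n)) ≤ c →
      ν ∈ {μ : ProbabilityMeasure (Eucl n) | ∀ k, μ (K k)ᶜ ≤ u k} := by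
    intro ν hν k
    have h1 := (sq_mul_measure_compl_closedBall_le_totalEnergy α (ν : Measure (Eucl n))
      (R := (k : ℝ) + 1) (by positivity)).trans hν
    rw [← ProbabilityMeasure.ennreal_coeFn_eq_coeFn_toMeasure,
      show ((k : ℝ) + 1) ^ 2 = ((((k : ℝ≥0) + 1) ^ 2 : ℝ≥0) : ℝ) by push_cast; rfl,
      ENNReal.ofReal_coe_nnreal] at h1
    have h2 : ((k : ℝ≥0) + 1) ^ 2 * ν (K k)ᶜ ≤ c := by
      rwa [← ENNReal.coe_mul, ENNReal.coe_le_coe] at h1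
    simp only [u]
    rw [le_div_iff₀ (by positivity), mul_comm]
    exact h2
  obtain ⟨μ, -, hmin⟩ := ((lowerSemicontinuous_totalEnergy hn hα).lowerSemicontinuousOn _
    ).exists_isMinOn ⟨σ, hmem σ hc'.ge⟩ hK
  refine ⟨μ, fun ν => ?_⟩
  rcases le_total (totalEnergy α (ν : Measure (Eucl n))) c with h | h
  · exact hmin (hmem ν h)
  · exact (hmin (hmem σ hc'.ge)).trans (hc'.ge.trans h)

/-! ### Compact support and uniqueness of minimisers -/

lemma mutualEnergy_mono [NeZero n] (α : ℝ) {μ ν : Measure (Eucl n)} [SFinite μ] [SFinite ν]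
    (h : μ ≤ ν) : mutualEnergy α μ μ ≤ mutualEnergy α ν ν :=
  lintegral_mono' (Measure.prod_mono h h) le_rfl

/-- The inequality behind the compactness of the support: `J` and `V` are the interaction energy and
the second moment of the restriction of a minimiser to a ball of radius `R`, `m` is the mass outside
the ball and `I` is the minimal energy. -/
lemma mass_eq_zero_of_energy_comparison {J V m I R : ℝ} (hJ : 0 ≤ J) (hV : 0 ≤ V) (hm : 0 ≤ m)
    (hm1 : m < 1) (hR : 8 * I < R ^ 2) (h1 : J + V + R ^ 2 * m ≤ I)
    (h2 : I ≤ J / (1 - m) ^ 2 + V / (1 - m)) : m = 0 := by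
  by_contra hne
  have hm0 : 0 < m := lt_of_le_of_ne hm (Ne.symm hne)
  have hI : 0 ≤ I := by nlinarith [sq_nonneg R]
  have hR0 : 0 < R ^ 2 := by linarith
  have h8 : m < 1 / 8 := by
    by_contra hcon
    push Not at hcon
    nlinarith
  have hb : 0 < 1 - m := by linarith
  have h3 : (J + V + R ^ 2 * m) * (1 - m) ^ 2 ≤ J + V * (1 - m) := by
    calc (J + V + R ^ 2 * m) * (1 - m) ^ 2 ≤ (J / (1 - m) ^ 2 + V / (1 - m)) * (1 - m) ^ 2 := by
          exact mul_le_mul_of_nonneg_right (h1.trans h2) (by positivity)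
      _ = J + V * (1 - m) := by field_simp
  have h4 : m * (R ^ 2 * (1 - m) ^ 2) ≤ m * (2 * (J + V)) := by
    nlinarith [mul_nonneg hJ (sq_nonneg m), mul_nonneg hV hm, mul_nonneg hV (sq_nonneg m)]
  have h5 := le_of_mul_le_mul_left h4 hm0
  have h6 : (1 : ℝ) / 2 ≤ (1 - m) ^ 2 := by nlinarith
  have h7 : J + V ≤ I := by nlinarith
  nlinarith

lemma isCompact_support_of_minimiser [NeZero n] {α : ℝ} {μ : ProbabilityMeasure (Eucl n)}
    (hfin : totalEnergy α (μ : Measure (Eucl n)) < ⊤)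
    (hmin : ∀ ν : ProbabilityMeasure (Eucl n),
      totalEnergy α (μ : Measure (Eucl n)) ≤ totalEnergy α (ν : Measure (Eucl n))) :
    IsCompact (μ : Measure (Eucl n)).support := by
  set M : Measure (Eucl n) := (μ : Measure (Eucl n)) with hM
  set I : ℝ := (totalEnergy α M).toReal with hI
  have hI0 : 0 ≤ I := ENNReal.toReal_nonneg
  -- any radius with `8 I < R²` works
  set R : ℝ := 8 * I + 1 with hR
  have hR1 : 8 * I < R ^ 2 := by nlinarith
  have hR0 : 0 ≤ R := by positivity
  set B := Metric.closedBall (0 : Eucl n) R with hB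
  have hBm : MeasurableSet B := Metric.isClosed_closedBall.measurableSet
  set m : ℝ := M.real Bᶜ with hm
  have hm0 : 0 ≤ m := measureReal_nonneg
  have hMB : M.real B = 1 - m := by rw [hm, probReal_compl_eq_one_sub hBm]; ring
  have hmark : R ^ 2 * m ≤ I := by
    have h := ENNReal.toReal_mono hfin.ne
      (sq_mul_measure_compl_closedBall_le_totalEnergy α M hR0)
    rwa [ENNReal.toReal_mul, ENNReal.toReal_ofReal (by positivity)] at h
  have hm1 : m < 1 := by
    by_contra hcon
    push Not at hcon
    nlinarith
  have hβ : 0 < 1 - m := by linarith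
  set ρ := M.restrict B with hρ
  have hJle : mutualEnergy α ρ ρ ≤ mutualEnergy α M M := mutualEnergy_mono α Measure.restrict_le_self
  have hsplit : secondMoment M = secondMoment ρ + ∫⁻ x in Bᶜ, ‖x‖ₑ ^ 2 ∂M :=
    (lintegral_add_compl _ hBm).symm
  have hsum : mutualEnergy α ρ ρ + secondMoment ρ + ENNReal.ofReal (R ^ 2) * M Bᶜ ≤
      totalEnergy α M := by
    rw [totalEnergy, hsplit, ← add_assoc]
    gcongr
    exact sq_mul_measure_compl_closedBall_le M hR0
  have hlt := hsum.trans_lt hfin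
  rw [ENNReal.add_lt_top, ENNReal.add_lt_top] at hlt
  obtain ⟨⟨hJfin, hVfin⟩, hmfin⟩ := hlt
  have h1 : (mutualEnergy α ρ ρ).toReal + (secondMoment ρ).toReal + R ^ 2 * m ≤ I := by
    have h := ENNReal.toReal_mono hfin.ne hsum
    rwa [ENNReal.toReal_add (ENNReal.add_lt_top.2 ⟨hJfin, hVfin⟩).ne hmfin.ne,
      ENNReal.toReal_add hJfin.ne hVfin.ne, ENNReal.toReal_mul,
      ENNReal.toReal_ofReal (by positivity)] at h
  -- the competitor is the normalised restriction to the ball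
  set c : ℝ≥0 := (1 - m)⁻¹.toNNReal
  have hc : (c : ℝ) = (1 - m)⁻¹ := Real.coe_toNNReal _ (by positivity)
  have hp : IsProbabilityMeasure (c • ρ) := by
    refine ⟨?_⟩
    rw [Measure.smul_apply, hρ, Measure.restrict_apply_univ, ENNReal.smul_def, smul_eq_mul,
      ← ofReal_measureReal, hMB, ← ENNReal.ofReal_coe_nnreal, hc,
      ← ENNReal.ofReal_mul (by positivity), inv_mul_cancel₀ hβ.ne', ENNReal.ofReal_one]
  have h2 : I ≤ (mutualEnergy α ρ ρ).toReal / (1 - m) ^ 2 + (secondMoment ρ).toReal / (1 - m) := by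
    have h := hmin ⟨c • ρ, hp⟩
    rw [ProbabilityMeasure.coe_mk, totalEnergy, totalEnergy, mutualEnergy_smul_smul,
      secondMoment_smul] at h
    have hcc : (c : ℝ≥0∞) * c * mutualEnergy α ρ ρ < ⊤ :=
      ENNReal.mul_lt_top (ENNReal.mul_lt_top ENNReal.coe_lt_top ENNReal.coe_lt_top) hJfin
    have hcv : (c : ℝ≥0∞) * secondMoment ρ < ⊤ := ENNReal.mul_lt_top ENNReal.coe_lt_top hVfin
    have h' := ENNReal.toReal_mono (ENNReal.add_lt_top.2 ⟨hcc, hcv⟩).ne h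
    rw [ENNReal.toReal_add hcc.ne hcv.ne, ENNReal.toReal_mul, ENNReal.toReal_mul,
      ENNReal.toReal_mul, ENNReal.coe_toReal] at h'
    refine (hI ▸ h').trans_eq ?_
    rw [hc]
    field_simp
  have hz := mass_eq_zero_of_energy_comparison ENNReal.toReal_nonneg ENNReal.toReal_nonneg hm0 hm1
    hR1 h1 h2
  have hz' : M Bᶜ = 0 := by
    rw [hm, measureReal_eq_zero_iff] at hz; exact hz
  exact (isCompact_closedBall (0 : Eucl n) R).of_isClosed_subset Measure.isClosed_support
    (Measure.support_subset_of_isClosed Metric.isClosed_closedBall (mem_ae_iff.2 hz'))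

lemma minimiser_unique [NeZero n] (hn : 3 ≤ n) {α : ℝ} (hα : -1 < α) (hα' : α ≤ (n : ℝ) - 2)
    {μ ν : ProbabilityMeasure (Eucl n)}
    (hμ : ∀ ρ : ProbabilityMeasure (Eucl n),
      totalEnergy α (μ : Measure (Eucl n)) ≤ totalEnergy α (ρ : Measure (Eucl n)))
    (hν : ∀ ρ : ProbabilityMeasure (Eucl n),
      totalEnergy α (ν : Measure (Eucl n)) ≤ totalEnergy α (ρ : Measure (Eucl n))) : μ = ν := by
  by_contra hne
  obtain ⟨σ, hσ⟩ := exists_totalEnergy_lt_top (n := n) hn α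
  have hst : (1 / 2 : ℝ≥0) + 1 / 2 = 1 := add_halves 1
  have h := totalEnergy_strictConvex hn hα hα' ((hμ σ).trans_lt hσ) ((hν σ).trans_lt hσ)
    (fun h => hne (Subtype.ext h)) (s := 1 / 2) (t := 1 / 2) (by positivity) (by positivity) hst
  rw [← le_antisymm (hμ ν) (hν μ), ← add_mul, ← ENNReal.coe_add, hst, ENNReal.coe_one,
    one_mul] at h
  let ρ : ProbabilityMeasure (Eucl n) :=
    ⟨_, isProbabilityMeasure_combination hst (μ : Measure (Eucl n)) (ν : Measure (Eucl n))⟩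
  exact (hμ ρ).not_gt h

/-! ### Tempered distributions given by locally integrable functions -/

/-- A nonnegative function which is integrable on the unit ball and bounded outside of it. Such
functions are tempered distributions. -/
structure IsTemperedWeight (f : Eucl n → ℝ) : Prop where
  measurable : Measurable f
  nonneg : ∀ x, 0 ≤ f x
  integrableOn : IntegrableOn f (Metric.ball 0 1)
  bounded : ∃ K, ∀ x, 1 ≤ ‖x‖ → f x ≤ K

lemma isTemperedWeight_of_le {f : Eucl n → ℝ} (hf : Measurable f) (h0 : ∀ x, 0 ≤ f x) {C : ℝ}
    (hC : 0 ≤ C) {k : ℕ} (hk : k < n) (h : ∀ x, x ≠ 0 → f x ≤ C * (1 / ‖x‖ ^ k)) :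
    IsTemperedWeight f := by
  refine ⟨hf, h0, ?_, C, fun x hx => ?_⟩
  · refine ((integrableOn_one_div_norm_pow hk 1).const_mul C).mono' hf.aestronglyMeasurable ?_
    filter_upwards [ae_restrict_of_ae (ae_ne_zero (by omega))] with x hx
    rw [Real.norm_of_nonneg (h0 x)]
    exact h x hx
  · refine (h x (norm_pos_iff.1 (by linarith))).trans (mul_le_of_le_one_right hC ?_)
    exact div_le_one_of_le₀ (one_le_pow₀ hx) (by positivity)

namespace IsTemperedWeight

variable {f : Eucl n → ℝ}

lemma integrable_smul (hf : IsTemperedWeight f) {F : Type*} [NormedAddCommGroup F]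
    [NormedSpace ℝ F] {g : Eucl n → F} (hg : Integrable g) {D : ℝ} (hD : ∀ x, ‖g x‖ ≤ D) :
    Integrable fun x => f x • g x := by
  obtain ⟨K, hK⟩ := hf.bounded
  have hm : AEStronglyMeasurable (fun x => f x • g x) :=
    hf.measurable.aestronglyMeasurable.smul hg.1
  have hB : MeasurableSet (Metric.ball (0 : Eucl n) 1) := Metric.isOpen_ball.measurableSet
  rw [← integrableOn_univ, ← union_compl_self (Metric.ball (0 : Eucl n) 1)]
  refine IntegrableOn.union ?_ ?_
  · refine (hf.integrableOn.const_mul D).mono' hm.restrict (ae_of_all _ fun x => ?_)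
    rw [norm_smul, Real.norm_of_nonneg (hf.nonneg x), mul_comm]
    exact mul_le_mul_of_nonneg_right (hD x) (hf.nonneg x)
  · refine (hg.norm.integrableOn.const_mul K).mono' hm.restrict ?_
    filter_upwards [ae_restrict_mem hB.compl] with x hx
    rw [norm_smul, Real.norm_of_nonneg (hf.nonneg x)]
    exact mul_le_mul_of_nonneg_right (hK x (by simpa using hx)) (norm_nonneg _)

lemma locallyIntegrable (hf : IsTemperedWeight f) : LocallyIntegrable f := by
  obtain ⟨K, hK⟩ := hf.bounded
  have hB : MeasurableSet (Metric.ball (0 : Eucl n) 1) := Metric.isOpen_ball.measurableSet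
  have h1 : LocallyIntegrable ((Metric.ball (0 : Eucl n) 1).indicator f) :=
    ((integrable_indicator_iff hB).2 hf.integrableOn).locallyIntegrable
  have h2 : LocallyIntegrable ((Metric.ball (0 : Eucl n) 1)ᶜ.indicator f) := by
    refine (locallyIntegrable_const K).mono
      (hf.measurable.indicator hB.compl).aestronglyMeasurable (ae_of_all _ fun x => ?_)
    by_cases hx : x ∈ (Metric.ball (0 : Eucl n) 1)ᶜ
    · rw [indicator_of_mem hx, Real.norm_of_nonneg (hf.nonneg x)]
      exact (hK x (by simpa using hx)).trans (le_abs_self K)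
    · rw [indicator_of_notMem hx, norm_zero]
      exact norm_nonneg K
  have := h1.add h2
  rwa [indicator_self_add_compl] at this

lemma integrable_mul_schwartz (hf : IsTemperedWeight f) (φ : 𝓢(Eucl n, ℂ)) :
    Integrable fun x => (f x : ℂ) * φ x := by
  simpa only [Complex.real_smul] using
    hf.integrable_smul φ.integrable (SchwartzMap.norm_le_seminorm ℝ φ)

lemma exists_isGivenByFunction (hf : IsTemperedWeight f) :
    ∃ T : 𝓢'(Eucl n, ℂ), IsGivenByFunction T f := by
  have hm : Measurable fun x => ENNReal.ofReal (f x) := hf.measurable.ennreal_ofReal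
  have hlt : ∀ᵐ x : Eucl n, ENNReal.ofReal (f x) < ⊤ := ae_of_all _ fun x => ENNReal.ofReal_lt_top
  have hμ : (volume.withDensity fun x : Eucl n => ENNReal.ofReal (f x)).HasTemperateGrowth := by
    refine ⟨n + 1, ?_⟩
    rw [integrable_withDensity_iff_integrable_smul' hm hlt]
    simp_rw [ENNReal.toReal_ofReal (hf.nonneg _)]
    refine hf.integrable_smul (D := 1) (integrable_one_add_norm (by simp)) fun x => ?_
    rw [Real.norm_of_nonneg (by positivity)]
    refine rpow_le_one_of_one_le_of_nonpos (by linarith [norm_nonneg x]) ?_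
    exact neg_nonpos.2 (Nat.cast_nonneg _)
  refine ⟨(volume.withDensity fun x : Eucl n => ENNReal.ofReal (f x)).toTemperedDistribution,
    fun φ => ⟨hf.integrable_mul_schwartz φ, ?_⟩⟩
  change ∫ x, φ x ∂(volume.withDensity fun x : Eucl n => ENNReal.ofReal (f x)) = _
  rw [integral_withDensity_eq_integral_toReal_smul hm hlt]
  simp_rw [ENNReal.toReal_ofReal (hf.nonneg _), Complex.real_smul]

end IsTemperedWeight

lemma isTemperedWeight_realPotential [NeZero n] (hn : 3 ≤ n) {α : ℝ} (hα : -1 < α) :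
    IsTemperedWeight (realPotential α : Eucl n → ℝ) :=
  isTemperedWeight_of_le (measurable_realPotential α) (realPotential_nonneg hn hα)
    (C := 1 + |α|) (by positivity) (k := n - 2) (by omega) fun x hx => by
      rw [mul_one_div]; exact realPotential_le hn α hx

/-! ### The Fourier transform of the potential -/

/-- The Fourier transform of the potential, a positive multiple of `quad α ξ / |ξ|⁴`. -/
def dualPotential [NeZero n] (α : ℝ) (ξ : Eucl n) : ℝ :=
  π ^ ((n : ℝ) / 2) / (2 * π ^ 2 * Gamma ((n : ℝ) / 2)) * (quad α ξ / ‖ξ‖ ^ 4)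

lemma gamma_half_dim_pos [NeZero n] : 0 < Gamma ((n : ℝ) / 2) := by
  have : (0 : ℝ) < n := by exact_mod_cast Nat.pos_of_ne_zero (NeZero.ne n)
  exact Gamma_pos_of_pos (by positivity)

lemma dualPotential_nonneg [NeZero n] (hn : 3 ≤ n) {α : ℝ} (hα : -1 < α)
    (hα' : α ≤ (n : ℝ) - 2) (ξ : Eucl n) : 0 ≤ dualPotential α ξ := by
  have := quad_nonneg hn hα hα' ξ
  have := gamma_half_dim_pos (n := n)
  unfold dualPotential
  positivity

lemma ae_dualPotential_pos [NeZero n] (hn : 3 ≤ n) {α : ℝ} (hα : -1 < α)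
    (hα' : α ≤ (n : ℝ) - 2) : ∀ᵐ ξ : Eucl n, 0 < dualPotential α ξ := by
  filter_upwards [ae_quad_pos hn hα hα', ae_ne_zero (NeZero.ne n)] with ξ h1 h2
  have := gamma_half_dim_pos (n := n)
  have := norm_pos_iff.2 h2
  unfold dualPotential
  positivity

lemma isTemperedWeight_dualPotential [NeZero n] (hn : 3 ≤ n) {α : ℝ} (hα : -1 < α)
    (hα' : α ≤ (n : ℝ) - 2) : IsTemperedWeight (dualPotential α : Eucl n → ℝ) := by
  have hG := gamma_half_dim_pos (n := n)
  have h3 : (3 : ℝ) ≤ n := by exact_mod_cast hn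
  have hc : 0 ≤ (n : ℝ) - 2 + α + 2 * |α| := by
    have : 0 ≤ (n : ℝ) - 2 + α := by linarith
    positivity
  refine isTemperedWeight_of_le ?_ (dualPotential_nonneg hn hα hα')
    (C := π ^ ((n : ℝ) / 2) / (2 * π ^ 2 * Gamma ((n : ℝ) / 2)) *
      ((n : ℝ) - 2 + α + 2 * |α|)) (by positivity) (k := 2) (by omega) fun ξ hξ => ?_
  · have := (continuous_quad (n := n) α).measurable
    unfold dualPotential
    fun_prop
  · have h := norm_pos_iff.2 hξ
    have hK : 0 ≤ π ^ ((n : ℝ) / 2) / (2 * π ^ 2 * Gamma ((n : ℝ) / 2)) := by positivity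
    rw [dualPotential, mul_assoc (π ^ ((n : ℝ) / 2) / _)]
    refine mul_le_mul_of_nonneg_left ?_ hK
    rw [mul_one_div, div_le_div_iff₀ (by positivity) (by positivity)]
    calc quad α ξ * ‖ξ‖ ^ 2
        ≤ (((n : ℝ) - 2 + α + 2 * |α|) * ‖ξ‖ ^ 2) * ‖ξ‖ ^ 2 := by
          gcongr; exact quad_le α ξ
      _ = _ := by ring

lemma integral_rpow_neg_mul_exp {a : ℝ} (ha : 0 < a) :
    IntegrableOn (fun t : ℝ => t ^ (-3 : ℝ) * exp (-(a / t))) (Ioi 0) ∧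
      ∫ t in Ioi (0 : ℝ), t ^ (-3 : ℝ) * exp (-(a / t)) = 1 / a ^ 2 := by
  have e : ∀ t ∈ Ioi (0 : ℝ), (|(-1 : ℝ)| * t ^ ((-1 : ℝ) - 1)) •
      ((fun s : ℝ => s ^ ((2 : ℝ) - 1) * exp (-(a * s))) (t ^ (-1 : ℝ))) =
      t ^ (-3 : ℝ) * exp (-(a / t)) := by
    intro t ht
    have ht : (0 : ℝ) < t := ht
    have h1 : (t ^ (-1 : ℝ)) ^ ((2 : ℝ) - 1) = t ^ (-1 : ℝ) := by norm_num
    simp only [h1, smul_eq_mul, abs_neg, abs_one, one_mul]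
    rw [← mul_assoc, ← rpow_add ht, rpow_neg_one, div_eq_mul_inv]
    norm_num
  constructor
  · exact ((integrableOn_Ioi_comp_rpow_iff _ (by norm_num)).2
      (integrableOn_rpow_mul_exp two_pos ha)).congr_fun e measurableSet_Ioi
  · rw [← setIntegral_congr_fun measurableSet_Ioi e, integral_comp_rpow_Ioi
      (fun s : ℝ => s ^ ((2 : ℝ) - 1) * exp (-(a * s))) (by norm_num : (-1 : ℝ) ≠ 0),
      integral_rpow_mul_exp_neg_mul_Ioi two_pos ha, Gamma_two, mul_one]
    rw [rpow_two, div_pow, one_pow]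

/-- The Gaussian decomposition of `dualPotential`, dual to that of the potential. -/
lemma integral_dualProfile [NeZero n] (α : ℝ) {ξ : Eucl n} (hξ : ξ ≠ 0) :
    IntegrableOn (fun t : ℝ => t ^ ((n : ℝ) / 2 - 1 - 1) *
      ((profileFactor n t)⁻¹ * dualProfile α t ξ)) (Ioi 0) ∧
    ∫ t in Ioi (0 : ℝ), t ^ ((n : ℝ) / 2 - 1 - 1) *
      ((profileFactor n t)⁻¹ * dualProfile α t ξ) =
        4 * Gamma ((n : ℝ) / 2) * dualPotential α ξ := by
  have h := norm_pos_iff.2 hξ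
  have hG := gamma_half_dim_pos (n := n)
  have ha : 0 < π ^ 2 * ‖ξ‖ ^ 2 := by positivity
  obtain ⟨h1, h2⟩ := integral_rpow_neg_mul_exp ha
  have e : ∀ t ∈ Ioi (0 : ℝ), (2 * π ^ 2 * π ^ ((n : ℝ) / 2) * quad α ξ) *
      (t ^ (-3 : ℝ) * exp (-(π ^ 2 * ‖ξ‖ ^ 2 / t))) =
      t ^ ((n : ℝ) / 2 - 1 - 1) * ((profileFactor n t)⁻¹ * dualProfile α t ξ) := by
    intro t ht
    have ht : (0 : ℝ) < t := ht
    have e1 : t ^ ((n : ℝ) / 2 - 1 - 1) = t ^ (-3 : ℝ) * t ^ ((n : ℝ) / 2) * t := by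
      rw [← rpow_add ht, ← rpow_add_one ht.ne']; congr 1; ring
    have e2 : exp (-(π ^ 2 / t) * ‖ξ‖ ^ 2) = exp (-(π ^ 2 * ‖ξ‖ ^ 2 / t)) := by
      congr 1; ring
    rw [e1, dualProfile, e2, profileFactor, div_rpow ht.le pi_pos.le]
    have h3 : 0 < t ^ ((n : ℝ) / 2) := by positivity
    have h4 : 0 < π ^ ((n : ℝ) / 2) := by positivity
    field_simp
  have h1' : IntegrableOn (fun t : ℝ => (2 * π ^ 2 * π ^ ((n : ℝ) / 2) * quad α ξ) *
      (t ^ (-3 : ℝ) * exp (-(π ^ 2 * ‖ξ‖ ^ 2 / t)))) (Ioi 0) := h1.const_mul _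
  refine ⟨h1'.congr_fun e measurableSet_Ioi, ?_⟩
  rw [← setIntegral_congr_fun measurableSet_Ioi e, integral_const_mul, h2, dualPotential]
  field_simp
  ring

lemma dualProfile_neg [NeZero n] (α t : ℝ) (ξ : Eucl n) :
    dualProfile α t (-ξ) = dualProfile α t ξ := by
  simp [dualProfile, quad]

lemma fourier_fourier_schwartz (φ : 𝓢(Eucl n, ℂ)) (ξ : Eucl n) :
    𝓕 (fun x => (𝓕 φ : 𝓢(Eucl n, ℂ)) x) ξ = φ (-ξ) := by
  have h0 : 𝓕⁻ (𝓕 φ : 𝓢(Eucl n, ℂ)) = φ := FourierTransform.fourierInv_fourier_eq φ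
  have h := congrArg (fun ψ : 𝓢(Eucl n, ℂ) => ψ (-ξ)) h0
  simp only [SchwartzMap.fourierInv_coe, Real.fourierInv_eq_fourier_neg, neg_neg] at h
  exact h

/-- Parseval's formula for the individual functions in the decomposition of the potential. -/
lemma integral_profile_mul_fourier [NeZero n] (α : ℝ) {t : ℝ} (ht : 0 < t)
    (φ : 𝓢(Eucl n, ℂ)) :
    ∫ x, (profile α t x : ℂ) * (𝓕 φ : 𝓢(Eucl n, ℂ)) x =
      ∫ ξ, (((profileFactor n t)⁻¹ * dualProfile α t ξ : ℝ) : ℂ) * φ ξ := by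
  have hc := profileFactor_pos (n := n) ht
  have hg : Integrable fun ξ : Eucl n => (dualProfile α t ξ : ℂ) :=
    (integrable_dualProfile α ht).ofReal
  have h := VectorFourier.integral_fourierIntegral_smul_eq_flip (L := innerₗ (Eucl n))
    (μ := volume) (ν := volume) (f := fun ξ : Eucl n => (dualProfile α t ξ : ℂ))
    (g := fun x => (𝓕 φ : 𝓢(Eucl n, ℂ)) x) continuous_fourierChar continuous_inner hg
    (𝓕 φ : 𝓢(Eucl n, ℂ)).integrable
  rw [flip_innerₗ] at h
  change ∫ x, 𝓕 (fun ξ : Eucl n => (dualProfile α t ξ : ℂ)) x • (𝓕 φ : 𝓢(Eucl n, ℂ)) x =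
    ∫ ξ, (dualProfile α t ξ : ℂ) • 𝓕 (fun x => (𝓕 φ : 𝓢(Eucl n, ℂ)) x) ξ at h
  simp_rw [fourier_dualProfile α ht, fourier_fourier_schwartz, smul_eq_mul] at h
  have h' : ∫ ξ, (dualProfile α t ξ : ℂ) * φ (-ξ) = ∫ ξ, (dualProfile α t ξ : ℂ) * φ ξ := by
    rw [← integral_neg_eq_self]
    simp_rw [dualProfile_neg, neg_neg]
  rw [h'] at h
  have hcc : ((profileFactor n t : ℝ) : ℂ) ≠ 0 := by exact_mod_cast hc.ne'
  simp_rw [Complex.ofReal_mul, mul_assoc, integral_const_mul] at h ⊢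
  rw [← h, Complex.ofReal_inv, inv_mul_cancel_left₀ hcc]

lemma integrable_profile_mul_schwartz [NeZero n] (hn : 3 ≤ n) {α : ℝ} (hα : -1 < α)
    (hα' : α ≤ (n : ℝ) - 2) (ψ : 𝓢(Eucl n, ℂ)) :
    Integrable (fun q : Eucl n × ℝ =>
      ((q.2 ^ ((n : ℝ) / 2 - 1 - 1) * profile α q.2 q.1 : ℝ) : ℂ) * ψ q.1)
      (volume.prod (volume.restrict (Ioi 0))) := by
  have hψ : Measurable ψ := ψ.continuous.measurable
  have hp : Measurable (fun q : Eucl n × ℝ => profile α q.2 q.1) :=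
    (continuous_profile α).measurable.comp
      (g := fun p : ℝ × Eucl n => profile α p.1 p.2) measurable_swap
  have hm : Measurable (fun q : Eucl n × ℝ =>
      ((q.2 ^ ((n : ℝ) / 2 - 1 - 1) * profile α q.2 q.1 : ℝ) : ℂ) * ψ q.1) := by
    fun_prop
  refine ⟨hm.aestronglyMeasurable, ?_⟩
  obtain ⟨C, hC⟩ := lintegral_profile_le_riesz (n := n) hn hα hα'
  obtain ⟨D, hD⟩ := riesz_le_potential (n := n) hn hα
  have hfin := ((isTemperedWeight_realPotential hn hα).integrable_mul_schwartz ψ).2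
  rw [hasFiniteIntegral_iff_enorm] at hfin ⊢
  rw [lintegral_prod _ hm.enorm.aemeasurable]
  calc ∫⁻ x, ∫⁻ t in Ioi (0 : ℝ),
        ‖((t ^ ((n : ℝ) / 2 - 1 - 1) * profile α t x : ℝ) : ℂ) * ψ x‖ₑ
      ≤ ∫⁻ x, (C * D : ℝ≥0∞) * ‖(realPotential α x : ℂ) * ψ x‖ₑ := by
        refine lintegral_mono_ae ?_
        filter_upwards [ae_ne_zero (NeZero.ne n)] with x hx
        have e : ∀ r : ℝ, ‖(r : ℂ)‖ₑ = ‖r‖ₑ := fun r => by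
          rw [← ofReal_norm, Complex.norm_real, ofReal_norm]
        simp_rw [enorm_mul, e]
        have hmx : Measurable fun t : ℝ => ‖t ^ ((n : ℝ) / 2 - 1 - 1) * profile α t x‖ₑ := by
          have := hp.comp (measurable_const.prodMk measurable_id : Measurable fun t : ℝ => (x, t))
          exact (Measurable.mul (by fun_prop) this).enorm
        rw [lintegral_mul_const _ hmx, ← mul_assoc]
        gcongr
        refine (hC x).trans ?_
        rw [mul_assoc]
        gcongr
        refine (hD x).trans_eq ?_
        rw [potential_of_ne α hx, Real.enorm_of_nonneg (realPotential_nonneg hn hα x)]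
    _ < ⊤ := by
        rw [lintegral_const_mul']
        · exact ENNReal.mul_lt_top (ENNReal.mul_lt_top ENNReal.coe_lt_top ENNReal.coe_lt_top) hfin
        · exact (ENNReal.mul_lt_top ENNReal.coe_lt_top ENNReal.coe_lt_top).ne

lemma integrable_dualProfile_mul_schwartz [NeZero n] (hn : 3 ≤ n) {α : ℝ} (hα : -1 < α)
    (hα' : α ≤ (n : ℝ) - 2) (φ : 𝓢(Eucl n, ℂ)) :
    Integrable (fun q : Eucl n × ℝ => ((q.2 ^ ((n : ℝ) / 2 - 1 - 1) *
      ((profileFactor n q.2)⁻¹ * dualProfile α q.2 q.1) : ℝ) : ℂ) * φ q.1)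
      (volume.prod (volume.restrict (Ioi 0))) := by
  have hφ : Measurable φ := φ.continuous.measurable
  have hm : Measurable (fun q : Eucl n × ℝ => ((q.2 ^ ((n : ℝ) / 2 - 1 - 1) *
      ((profileFactor n q.2)⁻¹ * dualProfile α q.2 q.1) : ℝ) : ℂ) * φ q.1) := by
    have := (continuous_quad (n := n) α).measurable
    unfold profileFactor dualProfile
    fun_prop
  rw [integrable_prod_iff hm.aestronglyMeasurable]
  constructor
  · filter_upwards [ae_ne_zero (NeZero.ne n)] with ξ hξ
    exact ((integral_dualProfile α hξ).1.ofReal (𝕜 := ℂ)).mul_const (φ ξ)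
  · refine (((isTemperedWeight_dualPotential hn hα hα').integrable_mul_schwartz φ).norm.const_mul
      (4 * Gamma ((n : ℝ) / 2))).congr ?_
    filter_upwards [ae_ne_zero (NeZero.ne n)] with ξ hξ
    have e : ∀ t ∈ Ioi (0 : ℝ), t ^ ((n : ℝ) / 2 - 1 - 1) *
        ((profileFactor n t)⁻¹ * dualProfile α t ξ) * ‖φ ξ‖ =
        ‖((t ^ ((n : ℝ) / 2 - 1 - 1) *
          ((profileFactor n t)⁻¹ * dualProfile α t ξ) : ℝ) : ℂ) * φ ξ‖ := by
      intro t ht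
      have ht : (0 : ℝ) < t := ht
      have h1 := profileFactor_pos (n := n) ht
      have h2 := quad_nonneg hn hα hα' ξ
      rw [norm_mul, Complex.norm_real, Real.norm_of_nonneg]
      unfold dualProfile
      positivity
    rw [← setIntegral_congr_fun measurableSet_Ioi e, integral_mul_const,
      (integral_dualProfile α hξ).2, norm_mul, Complex.norm_real,
      Real.norm_of_nonneg (dualPotential_nonneg hn hα hα' ξ)]
    ring

/-- The Fourier transform of the potential, tested against Schwartz functions. -/
lemma integral_realPotential_mul_fourier [NeZero n] (hn : 3 ≤ n) {α : ℝ} (hα : -1 < α)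
    (hα' : α ≤ (n : ℝ) - 2) (φ : 𝓢(Eucl n, ℂ)) :
    ∫ x, (realPotential α x : ℂ) * (𝓕 φ : 𝓢(Eucl n, ℂ)) x =
      ∫ ξ, (dualPotential α ξ : ℂ) * φ ξ := by
  have hG : ((4 * Gamma ((n : ℝ) / 2) : ℝ) : ℂ) ≠ 0 := by
    have := gamma_half_dim_pos (n := n)
    exact_mod_cast (by positivity : 4 * Gamma ((n : ℝ) / 2) ≠ 0)
  refine mul_left_cancel₀ hG ?_
  rw [← integral_const_mul, ← integral_const_mul]
  calc ∫ x, ((4 * Gamma ((n : ℝ) / 2) : ℝ) : ℂ) *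
        ((realPotential α x : ℂ) * (𝓕 φ : 𝓢(Eucl n, ℂ)) x)
      = ∫ x, ∫ t in Ioi (0 : ℝ), ((t ^ ((n : ℝ) / 2 - 1 - 1) * profile α t x : ℝ) : ℂ) *
          (𝓕 φ : 𝓢(Eucl n, ℂ)) x := by
        refine integral_congr_ae ?_
        filter_upwards [ae_ne_zero (NeZero.ne n)] with x hx
        rw [integral_mul_const, integral_complex_ofReal, integral_profile hn α hx, ← mul_assoc]
        push_cast
        ring
    _ = ∫ t in Ioi (0 : ℝ), ∫ x, ((t ^ ((n : ℝ) / 2 - 1 - 1) * profile α t x : ℝ) : ℂ) *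
          (𝓕 φ : 𝓢(Eucl n, ℂ)) x :=
        integral_integral_swap (integrable_profile_mul_schwartz hn hα hα' (𝓕 φ))
    _ = ∫ t in Ioi (0 : ℝ), ∫ ξ, ((t ^ ((n : ℝ) / 2 - 1 - 1) *
          ((profileFactor n t)⁻¹ * dualProfile α t ξ) : ℝ) : ℂ) * φ ξ := by
        refine setIntegral_congr_fun measurableSet_Ioi fun t ht => ?_
        simp only [Complex.ofReal_mul (t ^ ((n : ℝ) / 2 - 1 - 1)), mul_assoc, integral_const_mul]
        rw [integral_profile_mul_fourier α ht]
    _ = ∫ ξ, ∫ t in Ioi (0 : ℝ), ((t ^ ((n : ℝ) / 2 - 1 - 1) *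
          ((profileFactor n t)⁻¹ * dualProfile α t ξ) : ℝ) : ℂ) * φ ξ :=
        (integral_integral_swap (integrable_dualProfile_mul_schwartz hn hα hα' φ)).symm
    _ = _ := by
        refine integral_congr_ae ?_
        filter_upwards [ae_ne_zero (NeZero.ne n)] with ξ hξ
        rw [integral_mul_const, integral_complex_ofReal, (integral_dualProfile α hξ).2]
        push_cast
        ring

end AnisotropicEnergy

end

theorem proposition2p1 (n : ℕ) [NeZero n] (hn : 3 ≤ n) (α : ℝ) (hα : -1 < α)
    (hα' : α ≤ (n : ℝ) - 2) :
    -- the energy is well defined, with values in `[0, +∞]`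
    (∀ μ : ProbabilityMeasure (EuclideanSpace ℝ (Fin n)),
      EnergyWellDefined α (μ : Measure (EuclideanSpace ℝ (Fin n))) ∧
      0 ≤ energy α (μ : Measure (EuclideanSpace ℝ (Fin n)))) ∧
    -- the potential is a tempered distribution, whose Fourier transform is a locally integrable
    -- function that is positive almost everywhere
    (∃ T : 𝓢'(EuclideanSpace ℝ (Fin n), ℂ),
      IsGivenByFunction T (fun x => (interactionPotential α x).toReal) ∧
      ∃ w : EuclideanSpace ℝ (Fin n) → ℝ,
        LocallyIntegrable w ∧ (∀ᵐ ξ, 0 < w ξ) ∧ IsGivenByFunction (𝓕 T) w) ∧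
    -- strict convexity on the convex class of measures with compact support and finite
    -- interaction energy, where the energy is finite
    (Convex ℝ≥0 (compactFiniteEnergyClass n α) ∧
      (∀ μ ∈ compactFiniteEnergyClass n α, energy α μ < ⊤) ∧
      ∀ μ ∈ compactFiniteEnergyClass n α, ∀ ν ∈ compactFiniteEnergyClass n α, μ ≠ ν →
        ∀ s t : ℝ≥0, 0 < s → 0 < t → s + t = 1 →
          energy α (s • μ + t • ν) <
            ((s : ℝ) : EReal) * energy α μ + ((t : ℝ) : EReal) * energy α ν) ∧
    -- there is a unique minimiser; it has compact support and finite energy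
    (∃! μ : ProbabilityMeasure (EuclideanSpace ℝ (Fin n)), IsEnergyMinimiser α μ) ∧
    (∀ μ : ProbabilityMeasure (EuclideanSpace ℝ (Fin n)), IsEnergyMinimiser α μ →
      IsCompact (μ : Measure (EuclideanSpace ℝ (Fin n))).support ∧
      energy α (μ : Measure (EuclideanSpace ℝ (Fin n))) < ⊤) := by
  have energy_le_iff : ∀ μ ν : Measure (EuclideanSpace ℝ (Fin n)),
      energy α μ ≤ energy α ν ↔
        AnisotropicEnergy.totalEnergy α μ ≤ AnisotropicEnergy.totalEnergy α ν := fun μ ν => by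
    rw [AnisotropicEnergy.energy_eq hn hα, AnisotropicEnergy.energy_eq hn hα,
      EReal.coe_ennreal_le_coe_ennreal_iff]
  have energy_lt_top : ∀ μ : Measure (EuclideanSpace ℝ (Fin n)),
      AnisotropicEnergy.totalEnergy α μ < ⊤ → energy α μ < ⊤ := fun μ h => by
    rw [AnisotropicEnergy.energy_eq hn hα, ← EReal.coe_ennreal_top]
    exact EReal.coe_ennreal_lt_coe_ennreal_iff.2 h
  refine ⟨fun μ => ⟨AnisotropicEnergy.energyWellDefined hn hα _, ?_⟩, ?_, ⟨?_, ?_, ?_⟩, ?_, ?_⟩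
  · rw [AnisotropicEnergy.energy_eq hn hα]
    exact EReal.coe_ennreal_nonneg _
  · simp_rw [AnisotropicEnergy.toReal_interactionPotential hn]
    obtain ⟨T, hT⟩ :=
      (AnisotropicEnergy.isTemperedWeight_realPotential hn hα).exists_isGivenByFunction
    have hw := AnisotropicEnergy.isTemperedWeight_dualPotential hn hα hα'
    refine ⟨T, hT, AnisotropicEnergy.dualPotential α, hw.locallyIntegrable,
      AnisotropicEnergy.ae_dualPotential_pos hn hα hα', fun φ =>
        ⟨hw.integrable_mul_schwartz φ, ?_⟩⟩
    rw [TemperedDistribution.fourier_apply, (hT (𝓕 φ)).2]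
    exact AnisotropicEnergy.integral_realPotential_mul_fourier hn hα hα' φ
  · exact AnisotropicEnergy.convex_compactFiniteEnergyClass hn hα
  · exact fun μ hμ => energy_lt_top μ (AnisotropicEnergy.totalEnergy_lt_top_of_mem hn hα hμ)
  · intro μ hμ ν hν hne s t hs ht hst
    have : IsProbabilityMeasure μ := hμ.1
    have : IsProbabilityMeasure ν := hν.1
    exact AnisotropicEnergy.energy_lt_of_totalEnergy_lt hn hα
      (AnisotropicEnergy.totalEnergy_strictConvex hn hα hα'
        (AnisotropicEnergy.totalEnergy_lt_top_of_mem hn hα hμ)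
        (AnisotropicEnergy.totalEnergy_lt_top_of_mem hn hα hν) hne hs ht hst)
  · obtain ⟨μ, hμ⟩ := AnisotropicEnergy.exists_minimiser (n := n) hn hα
    refine ⟨μ, fun ν => (energy_le_iff _ _).2 (hμ ν), fun ν hν => ?_⟩
    exact AnisotropicEnergy.minimiser_unique hn hα hα'
      (fun ρ => (energy_le_iff _ _).1 (hν ρ)) hμ
  · intro μ hμ
    have hmin := fun ν => (energy_le_iff _ _).1 (hμ ν)
    obtain ⟨σ, hσ⟩ := AnisotropicEnergy.exists_totalEnergy_lt_top (n := n) hn α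
    have hfin := (hmin σ).trans_lt hσ
    exact ⟨AnisotropicEnergy.isCompact_support_of_minimiser hfin hmin, energy_lt_top _ hfin⟩
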